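/- **Setting.** Let $(X,d,\mu)$ be a metric measure space, i.e. a metric space with a Borel measure such that $0<\mu(B(x,r))<\infty$ for all open balls $B(x,r)$, $x\in X$, $r\in(0,\infty)$. For measurable $E\subseteq X$, $\mathcal P(E)$ is the class of measurable $q:E\to(0,\infty]$ with $\operatorname{ess\,inf}_E q>0$; $\mathcal P_b^{\log}(X)$ is the class of essentially bounded $p\in\mathcal P(X)$ such that, for some $C>0$, $\left|\frac1{p(x)}-\frac1{p(y)}\right|\le \frac{C}{\log(e+1/d(x,y))}$ for all $x,y\in X$. Write $f_E^-:=\operatorname{ess\,inf}_E f$, $f^+:=\operatorname{ess\,sup}_X f$, and $f\ll g$ if $\operatorname{ess\,inf}_X(g-f)>0$. With $\rho_{p(\cdot),E}(f):=\int_E|f(x)|^{p(x)}\,d\mu(x)$, the space $L^{p(\cdot)}(E)$ consists of the measurable $f$ with $\rho_{p(\cdot),E}(f)<\infty$ and has the Luxemburg quasi-norm $\|f\|_{L^{p(\cdot)}(E)}:=\inf\{\lambda>0:\rho_{p(\cdot),E}(f/\lambda)\le1\}$ (with $\inf\emptyset=\infty$). For a sequence $g=\{g_k\}_{k\in\mathbb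 Z}$ of measurable functions on $E$ and $q\in\mathcal P(E)$, let $$\|g\|_{L^{p(\cdot)}(\ell^{q(\cdot)}(E))}:=\Big\|\,\big\|\{g_k(x)\}_k\big\|_{\ell^{q(x)}}\Big\|_{L^{p(\cdot)}(E)},\qquad \|g\|_{\ell^{q(\cdot)}(L^{p(\cdot)}(E))}:=\inf\Big\{\lambda>0:\sum_{k\in\mathbb Z}\inf\big\{t>0:\rho_{p(\cdot),E}\big(\tfrac{g_k}{\lambda\, t^{1/q(\cdot)}}\big)\le1\big\}\le1\Big\},$$ with $t^{1/\infty}:=1$; the spaces $L^{p(\cdot)}(\ell^{q(\cdot)}(E))$ and $\ell^{q(\cdot)}(L^{p(\cdot)}(E))$ consist of the sequences with finite quasi-norm. For a measurable $u:E\to[-\infty,\infty]$ that is finite a.e., a sequence $g=\{g_k\}_{k\in\mathbb Z}$ of measurable functions $g_k:E\to[0,\infty]$ is a vector $s(\cdot)$-gradient of $u$ on $E$, $g\in\mathbb D^{s(\cdot)}(u)$, if there is a null set $N$ such that $$|u(x)-u(y)|\le d(x,y)^{s(x)}g_k(x)+d(x,y)^{s(y)}g_k(y)\quad\text{for all }k\in\mathbb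 Z,\ x,y\in E\setminus N\text{ with }2^{-k-1}\le d(x,y)<2^{-k}.$$ Then $u\in\dot M^{s(\cdot)}_{p(\cdot),q(\cdot)}(E)$ if $\inf_{g\in\mathbb D^{s(\cdot)}(u)}\|g\|_{L^{p(\cdot)}(\ell^{q(\cdot)}(E))}<\infty$, and $u\in\dot N^{s(\cdot)}_{p(\cdot),q(\cdot)}(E)$ if $\inf_{g\in\mathbb D^{s(\cdot)}(u)}\|g\|_{\ell^{q(\cdot)}(L^{p(\cdot)}(E))}<\infty$. **Theorem.** Let $(X,d,\mu)$ be a metric measure space, and let $Q,p,s\in\mathcal P_b^{\log}(X)$, $\delta\in(0,\infty)$, $b\in(0,1]$, $\sigma\in(1,\infty)$, with $\mu(B(x,r))\ge b\,r^{Q(x)}$ for all $x\in X$ and $r\in(0,\delta]$. In the following, $B_0:=B(x_0,r_0)$, $\sigma B_0:=B(x_0,\sigma r_0)$, and all constants are positive and depend only on $b,\delta,\sigma,p,s,Q$ (as functions on the metric space $(X,d)$; in particular not on $\mu$, the ball, $q$, $u$ or $g$). 1. If $sp\ll Q$, put $\gamma:=\frac{Qp}{Q-sp}$. There is a constant $C_S$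 such that for all balls $B_0$ with $0<r_0\le\delta/\sigma$, all $q\in\mathcal P(\sigma B_0)$, $u\in\dot M^{s(\cdot)}_{p(\cdot),q(\cdot)}(\sigma B_0)$ and $g\in\mathbb D^{s(\cdot)}(u)\cap L^{p(\cdot)}(\ell^{q(\cdot)}(\sigma B_0))$, $$\inf_{c\in\mathbb R}\|u-c\|_{L^{\gamma(\cdot)}(B_0)}\le C_S\left(\frac{\mu(B_0)}{r_0^{Q(x_0)}}\right)^{1/\gamma^-_{B_0}}\|g\|_{L^{p(\cdot)}(\ell^{q(\cdot)}(\sigma B_0))}.$$ 2. If $sp=Q$, there are constants $C_{MT1},C_{MT2}$ such that for all $B_0,q,u,g$ as in 1 with $\|g\|_{L^{p(\cdot)}(\ell^{q(\cdot)}(\sigma B_0))}>0$, the function $u$ is integrable on $B_0$ and, with $u_{B_0}:=\frac1{\mu(B_0)}\int_{B_0}u\,d\mu$, $$\frac1{\mu(B_0)}\int_{B_0}\exp\left(C_{MT1}\frac{|u(x)-u_{B_0}|}{\|g\|_{L^{p(\cdot)}(\ell^{q(\cdot)}(\sigma B_0))}}\right)d\mu(x)\le C_{MT2}.$$ 3.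 If $sp\gg Q$, put $\alpha:=s-\frac Qp$. There is a constant $C_H$ such that for all $B_0,q,u,g$ as in 1, the function $u$ is integrable on $B_0$, $$\|u-u_{B_0}\|_{L^\infty(B_0)}\le C_H\,r_0^{\alpha(x_0)}\,\|g\|_{L^{p(\cdot)}(\ell^{q(\cdot)}(\sigma B_0))},$$ and $u$ has a continuous representative $\tilde u$ on $B_0$ such that, for all $x,y\in B_0$, $$|\tilde u(x)-\tilde u(y)|\le D_H(r_0)\,\|g\|_{L^{p(\cdot)}(\ell^{q(\cdot)}(\sigma B_0))}\,d(x,y)^{\alpha(x)},\qquad D_H(r_0):=2^{\alpha^++1}C_H\left(\frac{\sigma\delta}{(\sigma-1)r_0}\right)^{\alpha^+}.$$ In addition, statements 1–3 remain valid, for those $q\in\mathcal P(\sigma B_0)$ with $q\le p$ on $\sigma B_0$, with $\dot M^{s(\cdot)}_{p(\cdot),q(\cdot)}$ replaced by $\dot N^{s(\cdot)}_{p(\cdot),q(\cdot)}$ and $L^{p(\cdot)}(\ell^{q(\cdot)})$ replaced by $\ell^{q(\cdot)}(L^{p(\cdot)})$. -/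

import Mathlib

open MeasureTheory Metric Set
open scoped ENNReal

namespace HajlaszVar

noncomputable section

/-! Functions with values in `[0, ∞]` are `ℝ≥0∞`-valued.  All function spaces below live on a set
`E ⊆ X`, regarded as a metric measure space with the restricted metric and the restricted measure;
a function on `E` is represented by any function on `X` that extends it.  Measurability is
measurability with respect to the completion (`AEMeasurable`). -/

/-- `(X, d, μ)` is a metric measure space: every ball of positive radius has positive and finite
measure. -/
def IsMetricMeasure {X : Type*} [MetricSpace X] [MeasurableSpace X] (μ : Measure X) : Prop :=
  ∀ (x : X) (r : ℝ), 0 < r → 0 < μ (ball x r) ∧ μ (ball x r) < ∞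

/-- The lower growth bound `μ (B(x, r)) ≥ b r ^ Q(x)` for all `x` and all `r ∈ (0, δ]`. -/
def LowerGrowth {X : Type*} [MetricSpace X] [MeasurableSpace X] (μ : Measure X)
    (Q : X → ℝ) (b δ : ℝ) : Prop :=
  ∀ (x : X) (r : ℝ), 0 < r → r ≤ δ → ENNReal.ofReal (b * r ^ Q x) ≤ μ (ball x r)

/-- Log-Hölder continuity: `|f x - f y| ≤ C / log (e + 1 / d(x, y))`
(for `x = y` the left-hand side vanishes). -/
def LogHolder {X : Type*} [MetricSpace X] (f : X → ℝ) : Prop :=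
  ∃ C : ℝ, 0 < C ∧ ∀ x y : X, |f x - f y| ≤ C / Real.log (Real.exp 1 + 1 / dist x y)

/-- The class `𝒫(E)`: measurable `q : E → (0, ∞]` with `ess inf q > 0`. -/
structure IsExponentOn {X : Type*} [MeasurableSpace X] (μ : Measure X) (E : Set X)
    (q : X → ℝ≥0∞) : Prop where
  aemeasurable : AEMeasurable q (μ.restrict E)
  pos : ∀ x ∈ E, 0 < q x
  essInf_pos : 0 < essInf q (μ.restrict E)

/-- The class `𝒫_b^log(X)`: measurable `p : X → (0, ∞)`, essentially bounded, essentially bounded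
away from `0`, with `1 / p` log-Hölder continuous. -/
structure IsBddLogExponent {X : Type*} [MetricSpace X] [MeasurableSpace X] (μ : Measure X)
    (p : X → ℝ) : Prop where
  aemeasurable : AEMeasurable p μ
  pos : ∀ x, 0 < p x
  ess_lower : ∃ c : ℝ, 0 < c ∧ ∀ᵐ x ∂μ, c ≤ p x
  ess_upper : ∃ C : ℝ, ∀ᵐ x ∂μ, p x ≤ C
  logHolder : LogHolder fun x => 1 / p x

/-- `f ≪ g`, that is `ess inf (g - f) > 0`. -/
def EssLT {X : Type*} [MeasurableSpace X] (μ : Measure X) (f g : X → ℝ) : Prop :=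
  ∃ c : ℝ, 0 < c ∧ ∀ᵐ x ∂μ, c ≤ g x - f x

/-- The modular `ρ_{p(·)}(f) = ∫_E f ^ p(x) dμ`. -/
def modular {X : Type*} [MeasurableSpace X] (μ : Measure X) (E : Set X) (p : X → ℝ)
    (f : X → ℝ≥0∞) : ℝ≥0∞ :=
  ∫⁻ x in E, f x ^ p x ∂μ

/-- The Luxemburg quasi-norm of `f` in `L^{p(·)}(E)` (equal to `∞` if the infimum is over `∅`). -/
def luxNorm {X : Type*} [MeasurableSpace X] (μ : Measure X) (E : Set X) (p : X → ℝ)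
    (f : X → ℝ≥0∞) : ℝ≥0∞ :=
  sInf {t : ℝ≥0∞ | 0 < t ∧ t < ∞ ∧ modular μ E p (fun x => f x / t) ≤ 1}

/-- `f ∈ L^{p(·)}(E)` (finiteness of the modular forces `f < ∞` almost everywhere). -/
def MemLvar {X : Type*} [MeasurableSpace X] (μ : Measure X) (E : Set X) (p : X → ℝ)
    (f : X → ℝ≥0∞) : Prop :=
  AEMeasurable f (μ.restrict E) ∧ modular μ E p f < ∞

/-- The `ℓ^q` quasi-norm of a sequence indexed by `ℤ`, for `q ∈ (0, ∞]`. -/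
def seqNorm (q : ℝ≥0∞) (a : ℤ → ℝ≥0∞) : ℝ≥0∞ :=
  if q = ∞ then ⨆ k, a k else (∑' k, a k ^ q.toReal) ^ (1 / q.toReal)

/-- The semi-modular of `ℓ^{q(·)}(L^{p(·)}(E))`:
`∑_k inf {t > 0 : ρ_{p(·)}(g_k / t ^ (1 / q(·))) ≤ 1}`, with `t ^ (1 / ∞) = 1`. -/
def besovModular {X : Type*} [MeasurableSpace X] (μ : Measure X) (E : Set X) (p : X → ℝ)
    (q : X → ℝ≥0∞) (g : ℤ → X → ℝ≥0∞) : ℝ≥0∞ :=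
  ∑' k, sInf {t : ℝ≥0∞ | 0 < t ∧ t < ∞ ∧
    modular μ E p (fun x => g k x / t ^ ((q x)⁻¹).toReal) ≤ 1}

/-- The two scales: Triebel-Lizorkin (`Ṁ`, built on `L^{p(·)}(ℓ^{q(·)})`) and
Besov (`Ṅ`, built on `ℓ^{q(·)}(L^{p(·)})`). -/
inductive Scale
  | triebelLizorkin
  | besov

/-- The quasi-norm of `L^{p(·)}(ℓ^{q(·)}(E))`, respectively of `ℓ^{q(·)}(L^{p(·)}(E))`. -/
def mixedNorm {X : Type*} [MeasurableSpace X] (A : Scale) (μ : Measure X) (E : Set X)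
    (p : X → ℝ) (q : X → ℝ≥0∞) (g : ℤ → X → ℝ≥0∞) : ℝ≥0∞ :=
  match A with
  | .triebelLizorkin => luxNorm μ E p fun x => seqNorm (q x) fun k => g k x
  | .besov => sInf {t : ℝ≥0∞ | 0 < t ∧ t < ∞ ∧ besovModular μ E p q (fun k x => g k x / t) ≤ 1}

/-- `g ∈ L^{p(·)}(ℓ^{q(·)}(E))`, respectively `g ∈ ℓ^{q(·)}(L^{p(·)}(E))`. -/
def MemMixed {X : Type*} [MeasurableSpace X] (A : Scale) (μ : Measure X) (E : Set X)
    (p : X → ℝ) (q : X → ℝ≥0∞) (g : ℤ → X → ℝ≥0∞) : Prop :=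
  match A with
  | .triebelLizorkin => MemLvar μ E p fun x => seqNorm (q x) fun k => g k x
  | .besov => (∀ k, MemLvar μ E p (g k)) ∧
      ∃ t : ℝ≥0∞, 0 < t ∧ t < ∞ ∧ besovModular μ E p q (fun k x => g k x / t) < ∞

/-- `g ∈ 𝔻^{s(·)}(u)` on `E`: the `g_k` are measurable with values in `[0, ∞]`, and off a null set
`|u(x) - u(y)| ≤ d(x,y)^{s(x)} g_k(x) + d(x,y)^{s(y)} g_k(y)`
whenever `2^{-k-1} ≤ d(x,y) < 2^{-k}`.  It is used for `u` finite almost everywhere, so the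
exceptional null set can absorb the points where `u` is infinite. -/
def IsVectorGradient {X : Type*} [MetricSpace X] [MeasurableSpace X] (μ : Measure X) (E : Set X)
    (s : X → ℝ) (u : X → EReal) (g : ℤ → X → ℝ≥0∞) : Prop :=
  (∀ k, AEMeasurable (g k) (μ.restrict E)) ∧
  ∃ N : Set X, μ N = 0 ∧ ∀ k : ℤ, ∀ x ∈ E \ N, ∀ y ∈ E \ N,
    (2 : ℝ) ^ (-k - 1) ≤ dist x y → dist x y < (2 : ℝ) ^ (-k) →
      ENNReal.ofReal |(u x).toReal - (u y).toReal| ≤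
        ENNReal.ofReal (dist x y ^ s x) * g k x + ENNReal.ofReal (dist x y ^ s y) * g k y

/-- The homogeneous quasi-semi-norm: the infimum of the mixed norms of all vector gradients. -/
def hajlaszSeminorm {X : Type*} [MetricSpace X] [MeasurableSpace X] (A : Scale) (μ : Measure X)
    (E : Set X) (s p : X → ℝ) (q : X → ℝ≥0∞) (u : X → EReal) : ℝ≥0∞ :=
  ⨅ (g : ℤ → X → ℝ≥0∞) (_ : IsVectorGradient μ E s u g), mixedNorm A μ E p q g

/-- `u ∈ Ṁ^{s(·)}_{p(·),q(·)}(E)`, respectively `u ∈ Ṅ^{s(·)}_{p(·),q(·)}(E)`: `u` is an extended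
real valued measurable function on `E`, finite almost everywhere, with finite semi-norm. -/
structure MemHajlasz {X : Type*} [MetricSpace X] [MeasurableSpace X] (A : Scale) (μ : Measure X)
    (E : Set X) (s p : X → ℝ) (q : X → ℝ≥0∞) (u : X → EReal) : Prop where
  aemeasurable : AEMeasurable u (μ.restrict E)
  finite_ae : ∀ᵐ x ∂(μ.restrict E), u x ≠ ⊤ ∧ u x ≠ ⊥
  seminorm_lt_top : hajlaszSeminorm A μ E s p q u < ∞

/-- The data quantified over after the constants: a ball `B(x₀, r₀)` with `0 < r₀ ≤ δ / σ`, an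
exponent `q ∈ 𝒫(B(x₀, σ r₀))` (with `q ≤ p` in the Besov case), a function `u` in the homogeneous
space over `B(x₀, σ r₀)`, and a vector gradient `g` of `u` in the mixed Lebesgue sequence space. -/
structure LocalData {X : Type*} [MetricSpace X] [MeasurableSpace X] (A : Scale) (μ : Measure X)
    (s p : X → ℝ) (δ σ : ℝ) (x₀ : X) (r₀ : ℝ) (q : X → ℝ≥0∞) (u : X → EReal)
    (g : ℤ → X → ℝ≥0∞) : Prop where
  radius_pos : 0 < r₀
  radius_le : r₀ ≤ δ / σ
  exponent : IsExponentOn μ (ball x₀ (σ * r₀)) q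
  exponent_le : A = Scale.besov → ∀ x ∈ ball x₀ (σ * r₀), q x ≤ ENNReal.ofReal (p x)
  mem_space : MemHajlasz A μ (ball x₀ (σ * r₀)) s p q u
  gradient : IsVectorGradient μ (ball x₀ (σ * r₀)) s u g
  gradient_mem : MemMixed A μ (ball x₀ (σ * r₀)) p q g

/-- The standing assumptions on the measure and the exponents. -/
structure Standing {X : Type*} [MetricSpace X] [MeasurableSpace X] (μ : Measure X)
    (Q p s : X → ℝ) (b δ : ℝ) : Prop where
  metricMeasure : IsMetricMeasure μ
  growth : LowerGrowth μ Q b δ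
  exponent_Q : IsBddLogExponent μ Q
  exponent_p : IsBddLogExponent μ p
  exponent_s : IsBddLogExponent μ s

end

end HajlaszVar

/-!
Every mixed norm dominates the `L^{p(·)}` norm of `G = sup_k g_k` (in the Besov scale this uses
`q ≤ p`), so `u` has the single Hajłasz gradient `G`. After normalising `u` by a number `m` slightly
larger than that norm, the density `h = (G / m) ^ p` has integral at most `1` over `σB₀`.

By Chebyshev's inequality and the lower growth of `μ`, every ball `B(y, ρ) ⊆ σB₀` contains a point
where `h ≤ (2 / b) ρ ^ (-Q(y))`. A point `x` with `h(x) ≈ ρ ^ (-Q(x)) 2 ^ J` is joined to such a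
point at scale `ρ` through points at the scales `ρ 2 ^ (-j / Q(x))`, `j ≤ J`. Log-Hölder continuity
allows all exponents to be frozen at `x`, so the step at scale `ρ'` changes `u / m` by at most a
constant times `ρ' ^ α(x)`, where `α = s - Q / p`. The resulting sum, geometric with ratio
`2 ^ (-α / Q)`, is a power of `h(x)` if `α < 0`, linear in `J` if `α = 0`, whence the exponential
integrability, and bounded by `ρ ^ α(x)` if `α > 0`.
-/

namespace HajlaszVar

/-! ### Log-Hölder continuity -/

section LogHolder

variable {X : Type*} [MetricSpace X] {f g : X → ℝ}

lemma one_le_log_exp_one_add {d : ℝ} (hd : 0 ≤ d) : 1 ≤ Real.log (Real.exp 1 + 1 / d) := by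
  have : (0 : ℝ) ≤ 1 / d := by positivity
  rw [Real.le_log_iff_exp_le (by positivity)]
  linarith

lemma abs_log_le_mul_log_exp_one_add {ρ R K d : ℝ} (hρ : 0 < ρ) (hρR : ρ ≤ R) (hK : 0 < K)
    (hd : 0 < d) (hdρ : d ≤ K * ρ) :
    |Real.log ρ| ≤ (1 + |Real.log K| + |Real.log R|) * Real.log (Real.exp 1 + 1 / d) := by
  set l := Real.log (Real.exp 1 + 1 / d)
  have hl : 1 ≤ l := one_le_log_exp_one_add hd.le
  have hupper : Real.log ρ ≤ |Real.log R| := (Real.log_le_log hρ hρR).trans (le_abs_self _)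
  have hlower : -Real.log ρ ≤ |Real.log K| + l := by
    have hinv : Real.log (1 / d) ≤ l :=
      Real.log_le_log (by positivity) (le_add_of_nonneg_left (Real.exp_pos 1).le)
    have hlogd : Real.log d ≤ Real.log K + Real.log ρ := by
      rw [← Real.log_mul hK.ne' hρ.ne']
      exact Real.log_le_log hd hdρ
    rw [one_div, Real.log_inv] at hinv
    linarith [le_abs_self (Real.log K)]
  rw [abs_le]
  constructor <;> nlinarith [abs_nonneg (Real.log K), abs_nonneg (Real.log R)]

lemma LogHolder.continuous (hf : LogHolder f) : Continuous f := by
  obtain ⟨C, hC, h⟩ := hf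
  refine Metric.continuous_iff.2 fun x ε hε => ⟨Real.exp (-(C / ε)), Real.exp_pos _, fun y hy => ?_⟩
  rcases eq_or_ne y x with rfl | hne
  · simpa using hε
  have hd : 0 < dist y x := dist_pos.2 hne
  have hlog : C / ε < Real.log (Real.exp 1 + 1 / dist y x) := by
    rw [Real.lt_log_iff_exp_lt (by positivity)]
    have : Real.exp (C / ε) < 1 / dist y x := by
      rwa [lt_one_div (Real.exp_pos _) hd, one_div, ← Real.exp_neg]
    linarith [Real.exp_pos 1]
  rw [Real.dist_eq]
  refine (h y x).trans_lt ?_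
  rwa [div_lt_comm₀ (lt_trans (by positivity) hlog) hε]

lemma LogHolder.neg (hf : LogHolder f) : LogHolder fun x => -f x := by
  obtain ⟨C, hC, h⟩ := hf
  refine ⟨C, hC, fun x y => ?_⟩
  rw [← neg_sub', abs_neg]
  exact h x y

lemma LogHolder.sub (hf : LogHolder f) (hg : LogHolder g) : LogHolder fun x => f x - g x := by
  obtain ⟨C, hC, h⟩ := hf
  obtain ⟨C', hC', h'⟩ := hg
  refine ⟨C + C', by positivity, fun x y => ?_⟩
  calc |f x - g x - (f y - g y)| = |(f x - f y) - (g x - g y)| := by ring_nf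
    _ ≤ |f x - f y| + |g x - g y| := abs_sub _ _
    _ ≤ _ := by rw [add_div]; exact add_le_add (h x y) (h' x y)

lemma LogHolder.mul (hf : LogHolder f) (hg : LogHolder g) {A B : ℝ} (hA : ∀ x, |f x| ≤ A)
    (hB : ∀ x, |g x| ≤ B) : LogHolder fun x => f x * g x := by
  obtain ⟨C, hC, h⟩ := hf
  obtain ⟨C', hC', h'⟩ := hg
  rcases isEmpty_or_nonempty X with hX | ⟨⟨x₀⟩⟩
  · exact ⟨1, one_pos, fun x => hX.elim x⟩
  have hA0 : 0 ≤ A := (abs_nonneg _).trans (hA x₀)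
  have hB0 : 0 ≤ B := (abs_nonneg _).trans (hB x₀)
  refine ⟨A * C' + B * C + 1, by positivity, fun x y => ?_⟩
  have hl : 0 < Real.log (Real.exp 1 + 1 / dist x y) :=
    one_pos.trans_le (one_le_log_exp_one_add dist_nonneg)
  calc |f x * g x - f y * g y| = |f x * (g x - g y) + g y * (f x - f y)| := by ring_nf
    _ ≤ |f x| * |g x - g y| + |g y| * |f x - f y| := by
        rw [← abs_mul, ← abs_mul]; exact abs_add_le _ _
    _ ≤ A * (C' / Real.log (Real.exp 1 + 1 / dist x y)) +
        B * (C / Real.log (Real.exp 1 + 1 / dist x y)) := by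
        gcongr
        exacts [hA x, h' x y, hB y, h x y]
    _ ≤ (A * C' + B * C + 1) / Real.log (Real.exp 1 + 1 / dist x y) := by
        rw [mul_div_assoc', mul_div_assoc', ← add_div]
        exact div_le_div_of_nonneg_right (by linarith) hl.le

lemma LogHolder.of_one_div (hf : LogHolder fun x => 1 / f x) (h0 : ∀ x, 0 < f x) {A : ℝ}
    (hA : ∀ x, f x ≤ A) : LogHolder f := by
  obtain ⟨C, hC, h⟩ := hf
  rcases isEmpty_or_nonempty X with hX | ⟨⟨x₀⟩⟩
  · exact ⟨1, one_pos, fun x => hX.elim x⟩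
  have hA0 : 0 < A := (h0 x₀).trans_le (hA x₀)
  refine ⟨A * A * C, by positivity, fun x y => ?_⟩
  have hx := h0 x
  have hy := h0 y
  have hfactor : f x - f y = f x * f y * (1 / f y - 1 / f x) := by field_simp
  calc |f x - f y| = f x * f y * |1 / f y - 1 / f x| := by
        rw [hfactor, abs_mul, abs_of_pos (mul_pos hx hy)]
    _ ≤ A * A * (C / Real.log (Real.exp 1 + 1 / dist x y)) := by
        rw [abs_sub_comm]
        gcongr
        exacts [hA x, hA y, h x y]
    _ = _ := by ring

lemma LogHolder.rpow_le (hf : LogHolder f) {R K : ℝ} (hK : 0 < K) :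
    ∃ C : ℝ, 1 ≤ C ∧ ∀ (x y : X) (ρ : ℝ), 0 < ρ → ρ ≤ R → dist x y ≤ K * ρ →
      ρ ^ f x ≤ C * ρ ^ f y := by
  obtain ⟨C, hC, h⟩ := hf
  refine ⟨Real.exp (C * (1 + |Real.log K| + |Real.log R|)),
    Real.one_le_exp (by positivity), fun x y ρ hρ hρR hd => ?_⟩
  rcases eq_or_ne x y with rfl | hne
  · exact le_mul_of_one_le_left (by positivity) (Real.one_le_exp (by positivity))
  have hd0 : 0 < dist x y := dist_pos.2 hne
  have hl : 0 < Real.log (Real.exp 1 + 1 / dist x y) :=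
    one_pos.trans_le (one_le_log_exp_one_add hd0.le)
  have hdiff := h x y
  have hlog := abs_log_le_mul_log_exp_one_add hρ hρR hK hd0 hd
  set l := Real.log (Real.exp 1 + 1 / dist x y)
  have hexponent : Real.log ρ * (f x - f y) ≤ C * (1 + |Real.log K| + |Real.log R|) := by
    calc Real.log ρ * (f x - f y) ≤ |Real.log ρ| * |f x - f y| := by
          rw [← abs_mul]; exact le_abs_self _
      _ ≤ ((1 + |Real.log K| + |Real.log R|) * l) * (C / l) := by gcongr
      _ = _ := by field_simp
  rw [Real.rpow_def_of_pos hρ, Real.rpow_def_of_pos hρ, ← Real.exp_add, Real.exp_le_exp]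
  linarith

end LogHolder

/-! ### The exponents -/

/-- The quantitative form of the hypotheses on the exponents `Q`, `p`, `s`, with bounds holding at
every point; it no longer refers to a measure. As in the class `𝒫_b^log`, log-Hölder continuity of
`p` is that of `1 / p`. -/
structure Exponents {X : Type*} [MetricSpace X] (Q p s : X → ℝ) (lo hi : ℝ) : Prop where
  lo_pos : 0 < lo
  Q_mem : ∀ x, Q x ∈ Icc lo hi
  p_mem : ∀ x, p x ∈ Icc lo hi
  s_mem : ∀ x, s x ∈ Icc lo hi
  logHolder_Q : LogHolder Q
  logHolder_one_div_p : LogHolder fun x => 1 / p x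
  logHolder_s : LogHolder s

/-- The differential dimension `s - Q / p` (the paper's `α`), whose sign separates the Sobolev,
Moser–Trudinger and Morrey cases. -/
noncomputable def diffDim {X : Type*} (Q p s : X → ℝ) (x : X) : ℝ := s x - Q x / p x

/-- The Sobolev conjugate exponent of `p` in dimension `Q` and smoothness `s` (the paper's `γ`);
it is meant for `s p < Q` only. -/
noncomputable def sobolevExponent {X : Type*} (Q p s : X → ℝ) (x : X) : ℝ :=
  Q x * p x / (Q x - s x * p x)

namespace Exponents

variable {X : Type*} [MetricSpace X] {Q p s : X → ℝ} {lo hi : ℝ}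

lemma hi_pos (hE : Exponents Q p s lo hi) (x : X) : 0 < hi :=
  hE.lo_pos.trans_le ((hE.Q_mem x).1.trans (hE.Q_mem x).2)

lemma Q_pos (hE : Exponents Q p s lo hi) (x : X) : 0 < Q x :=
  hE.lo_pos.trans_le (hE.Q_mem x).1

lemma p_pos (hE : Exponents Q p s lo hi) (x : X) : 0 < p x :=
  hE.lo_pos.trans_le (hE.p_mem x).1

lemma s_pos (hE : Exponents Q p s lo hi) (x : X) : 0 < s x :=
  hE.lo_pos.trans_le (hE.s_mem x).1

lemma diffDim_eq_div (hE : Exponents Q p s lo hi) (x : X) :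
    diffDim Q p s x = (s x * p x - Q x) / p x := by
  have := (hE.p_pos x).ne'
  rw [diffDim]
  field_simp

lemma sobolevExponent_eq_div (hE : Exponents Q p s lo hi) (x : X) :
    sobolevExponent Q p s x = Q x / -diffDim Q p s x := by
  rw [hE.diffDim_eq_div, ← neg_div, neg_sub, div_div_eq_mul_div, sobolevExponent]

lemma diffDim_le (hE : Exponents Q p s lo hi) (x : X) : diffDim Q p s x ≤ hi := by
  have := (hE.s_mem x).2
  have : 0 < Q x / p x := div_pos (hE.Q_pos x) (hE.p_pos x)
  rw [diffDim]
  linarith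

lemma logHolder_diffDim (hE : Exponents Q p s lo hi) : LogHolder (diffDim Q p s) := by
  unfold diffDim
  have h := hE.logHolder_s.sub (hE.logHolder_Q.mul hE.logHolder_one_div_p (A := hi) (B := 1 / lo)
    (fun x => by rw [abs_of_pos (hE.Q_pos x)]; exact (hE.Q_mem x).2)
    (fun x => by
      rw [abs_of_pos (one_div_pos.2 (hE.p_pos x))]
      exact one_div_le_one_div_of_le hE.lo_pos (hE.p_mem x).1))
  simpa only [mul_one_div] using h

end Exponents

section Everywhere

variable {X : Type*} [MetricSpace X] [MeasurableSpace X] {μ : Measure X} {Q p s f g : X → ℝ}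
  {b δ : ℝ}

lemma IsMetricMeasure.isOpenPosMeasure (hμ : IsMetricMeasure μ) : μ.IsOpenPosMeasure := by
  refine ⟨fun U hU ⟨x, hx⟩ h0 => ?_⟩
  obtain ⟨r, hr, hrU⟩ := Metric.isOpen_iff.1 hU x hx
  exact (hμ x r hr).1.ne' (measure_mono_null hrU h0)

lemma IsMetricMeasure.le_of_ae_le (hμ : IsMetricMeasure μ) (hf : Continuous f) {c : ℝ}
    (h : ∀ᵐ x ∂μ, c ≤ f x) (x : X) : c ≤ f x := by
  have := hμ.isOpenPosMeasure
  by_contra! hx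
  have ho : IsOpen {y | f y < c} := isOpen_lt hf continuous_const
  have h0 : μ {y | f y < c} = 0 := by simpa only [ae_iff, not_le] using h
  exact ho.measure_ne_zero μ ⟨x, hx⟩ h0

lemma IsBddLogExponent.continuous (hp : IsBddLogExponent μ p) : Continuous p := by
  have h := hp.logHolder.continuous.inv₀ fun x => (one_div_pos.2 (hp.pos x)).ne'
  simpa only [one_div, Pi.inv_def, inv_inv] using h

lemma IsBddLogExponent.exists_bounds (hp : IsBddLogExponent μ p) (hμ : IsMetricMeasure μ) :
    ∃ c C : ℝ, 0 < c ∧ ∀ x, p x ∈ Icc c C := by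
  obtain ⟨c, hc, hl⟩ := hp.ess_lower
  obtain ⟨C, hu⟩ := hp.ess_upper
  refine ⟨c, C, hc, fun x => ⟨hμ.le_of_ae_le hp.continuous hl x, neg_le_neg_iff.1 ?_⟩⟩
  exact hμ.le_of_ae_le hp.continuous.neg (hu.mono fun _ => neg_le_neg) x

lemma Standing.exponents (h : Standing μ Q p s b δ) : ∃ lo hi, Exponents Q p s lo hi := by
  obtain ⟨c₁, C₁, h₁, H₁⟩ := h.exponent_Q.exists_bounds h.metricMeasure
  obtain ⟨c₂, C₂, h₂, H₂⟩ := h.exponent_p.exists_bounds h.metricMeasure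
  obtain ⟨c₃, C₃, h₃, H₃⟩ := h.exponent_s.exists_bounds h.metricMeasure
  refine ⟨min c₁ (min c₂ c₃), max C₁ (max C₂ C₃), by positivity,
    fun x => Icc_subset_Icc ?_ ?_ (H₁ x), fun x => Icc_subset_Icc ?_ ?_ (H₂ x),
    fun x => Icc_subset_Icc ?_ ?_ (H₃ x),
    h.exponent_Q.logHolder.of_one_div h.exponent_Q.pos fun x => (H₁ x).2,
    h.exponent_p.logHolder,
    h.exponent_s.logHolder.of_one_div h.exponent_s.pos fun x => (H₃ x).2⟩
  all_goals simp

lemma EssLT.exists_le_sub_div (hlt : EssLT μ f g) (hμ : IsMetricMeasure μ) (hf : Continuous f)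
    (hg : Continuous g) (hp : IsBddLogExponent μ p) :
    ∃ c : ℝ, 0 < c ∧ ∀ x, c ≤ (g x - f x) / p x := by
  obtain ⟨c, hc, hle⟩ := hlt
  obtain ⟨_, P, -, hP⟩ := hp.exists_bounds hμ
  refine ⟨c / max P 1, by positivity, fun x => ?_⟩
  have hle' := hμ.le_of_ae_le (hg.sub hf) hle x
  exact div_le_div₀ (hc.le.trans hle') hle' (hp.pos x) ((hP x).2.trans (le_max_left _ _))

lemma Standing.exists_diffDim_le_neg (h : Standing μ Q p s b δ)
    (hlt : EssLT μ (fun x => s x * p x) Q) : ∃ c : ℝ, 0 < c ∧ ∀ x, diffDim Q p s x ≤ -c := by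
  obtain ⟨lo, hi, hE⟩ := h.exponents
  obtain ⟨c, hc, hle⟩ := hlt.exists_le_sub_div h.metricMeasure
    (h.exponent_s.continuous.mul h.exponent_p.continuous) h.exponent_Q.continuous h.exponent_p
  refine ⟨c, hc, fun x => ?_⟩
  rw [hE.diffDim_eq_div, le_neg, ← neg_div, neg_sub]
  exact hle x

lemma Standing.exists_le_diffDim (h : Standing μ Q p s b δ)
    (hlt : EssLT μ Q fun x => s x * p x) : ∃ c : ℝ, 0 < c ∧ ∀ x, c ≤ diffDim Q p s x := by
  obtain ⟨lo, hi, hE⟩ := h.exponents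
  simp only [hE.diffDim_eq_div]
  exact hlt.exists_le_sub_div h.metricMeasure h.exponent_Q.continuous
    (h.exponent_s.continuous.mul h.exponent_p.continuous) h.exponent_p

end Everywhere

/-! ### Chaining -/

/-- `h ^ (1 / p)` is a scalar Hajłasz gradient of `u` on `D`. It is encoded through `h`, the
integrand of the modular, because the chaining argument selects points according to `h`. -/
structure IsScalarGradient {X : Type*} [MetricSpace X] (p s : X → ℝ) (D : Set X)
    (u h : X → ℝ) : Prop where
  nonneg : ∀ x, 0 ≤ h x
  abs_sub_le : ∀ x ∈ D, ∀ y ∈ D,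
    |u x - u y| ≤ dist x y ^ s x * h x ^ (1 / p x) + dist x y ^ s y * h y ^ (1 / p y)

/-- Every ball `B(y, ρ) ⊆ U` of radius at most `δ` contains a point of `D` at which `h` is at most
`M ρ ^ (-Q(y))`. This is all that the chaining argument retains of the measure. -/
def HasModerateValues {X : Type*} [MetricSpace X] (Q : X → ℝ) (M δ : ℝ) (U D : Set X)
    (h : X → ℝ) : Prop :=
  ∀ (y : X) (ρ : ℝ), 0 < ρ → ρ ≤ δ → ball y ρ ⊆ U →
    ∃ z ∈ D, dist y z < ρ ∧ h z ≤ M * ρ ^ (-Q y)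

section Step

variable {X : Type*} [MetricSpace X] {Q p s : X → ℝ} {lo hi : ℝ}

lemma Exponents.rpow_s_le (hE : Exponents Q p s lo hi) {K : ℝ} (hK : 1 ≤ K) (R : ℝ) :
    ∃ C : ℝ, 0 < C ∧ ∀ (x z : X) (ρ d : ℝ), 0 < ρ → ρ ≤ R → dist x z ≤ K * ρ →
      0 ≤ d → d ≤ K * ρ → d ^ s z ≤ C * ρ ^ s x := by
  obtain ⟨C, hC, hs⟩ := hE.logHolder_s.rpow_le (R := R) (K := K) (by positivity)
  refine ⟨K ^ hi * C, by positivity, fun x z ρ d hρ hρR hxz hd hdK => ?_⟩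
  calc d ^ s z ≤ (K * ρ) ^ s z := Real.rpow_le_rpow hd hdK (hE.s_pos z).le
    _ = K ^ s z * ρ ^ s z := Real.mul_rpow (by positivity) hρ.le
    _ ≤ K ^ hi * (C * ρ ^ s x) := by
      gcongr
      · exact (hE.s_mem z).2
      · exact hs z x ρ hρ hρR (by rwa [dist_comm])
    _ = K ^ hi * C * ρ ^ s x := by ring

lemma Exponents.rpow_one_div_p_le (hE : Exponents Q p s lo hi) {K A : ℝ} (hK : 0 < K)
    (hA : 1 ≤ A) (R : ℝ) :
    ∃ C : ℝ, 0 < C ∧ ∀ (x z : X) (ρ a : ℝ), 0 < ρ → ρ ≤ R → dist x z ≤ K * ρ →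
      0 ≤ a → a ≤ A * ρ ^ (-Q x) → a ^ (1 / p z) ≤ C * ρ ^ (-(Q x / p x)) := by
  obtain ⟨C, hC, hp⟩ := hE.logHolder_one_div_p.neg.rpow_le (R := R) hK
  refine ⟨A ^ (1 / lo) * C ^ hi, by positivity, fun x z ρ a hρ hρR hxz ha haA => ?_⟩
  have hQx := hE.Q_pos x
  have hpz := hE.p_pos z
  have hpow : (ρ ^ (-(1 / p z))) ^ Q x ≤ C ^ hi * ρ ^ (-(Q x / p x)) := by
    calc (ρ ^ (-(1 / p z))) ^ Q x ≤ (C * ρ ^ (-(1 / p x))) ^ Q x := by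
          gcongr
          exact hp z x ρ hρ hρR (by rwa [dist_comm])
      _ = C ^ Q x * ρ ^ (-(Q x / p x)) := by
          rw [Real.mul_rpow (by positivity) (by positivity), ← Real.rpow_mul hρ.le]
          ring_nf
      _ ≤ C ^ hi * ρ ^ (-(Q x / p x)) := by
          gcongr
          exact (hE.Q_mem x).2
  calc a ^ (1 / p z) ≤ (A * ρ ^ (-Q x)) ^ (1 / p z) := by gcongr
    _ = A ^ (1 / p z) * (ρ ^ (-(1 / p z))) ^ Q x := by
        rw [Real.mul_rpow (by positivity) (by positivity), ← Real.rpow_mul hρ.le,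
          ← Real.rpow_mul hρ.le]
        ring_nf
    _ ≤ A ^ (1 / lo) * (C ^ hi * ρ ^ (-(Q x / p x))) := by
        gcongr
        exacts [hE.lo_pos, (hE.p_mem z).1]
    _ = A ^ (1 / lo) * C ^ hi * ρ ^ (-(Q x / p x)) := by ring

lemma Exponents.abs_sub_le_rpow_diffDim (hE : Exponents Q p s lo hi) {K A : ℝ} (hK : 1 ≤ K)
    (hA : 1 ≤ A) (R : ℝ) :
    ∃ C : ℝ, 0 < C ∧ ∀ (D : Set X) (u h : X → ℝ), IsScalarGradient p s D u h →
      ∀ (x z w : X) (ρ : ℝ), 0 < ρ → ρ ≤ R → z ∈ D → w ∈ D → dist x z ≤ K * ρ →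
      dist x w ≤ K * ρ → h z ≤ A * ρ ^ (-Q x) → h w ≤ A * ρ ^ (-Q x) →
      |u z - u w| ≤ C * ρ ^ diffDim Q p s x := by
  obtain ⟨C₁, hC₁, hs⟩ := hE.rpow_s_le (K := 2 * K) (by linarith) R
  obtain ⟨C₂, hC₂, hp⟩ := hE.rpow_one_div_p_le (K := K) (by positivity) hA R
  refine ⟨2 * (C₁ * C₂), by positivity,
    fun D u h hu x z w ρ hρ hρR hz hw hxz hxw hhz hhw => ?_⟩
  have hzw : dist z w ≤ 2 * K * ρ := by
    have := dist_triangle_left z w x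
    linarith
  have hKρ : 0 ≤ K * ρ := by positivity
  have hterm : ∀ y, dist x y ≤ K * ρ → h y ≤ A * ρ ^ (-Q x) →
      dist z w ^ s y * h y ^ (1 / p y) ≤ C₁ * C₂ * ρ ^ diffDim Q p s x := by
    intro y hxy hhy
    calc dist z w ^ s y * h y ^ (1 / p y) ≤ C₁ * ρ ^ s x * (C₂ * ρ ^ (-(Q x / p x))) := by
          have := hu.nonneg y
          gcongr
          exacts [hs x y ρ _ hρ hρR (by linarith) dist_nonneg hzw,
            hp x y ρ _ hρ hρR hxy this hhy]
      _ = C₁ * C₂ * (ρ ^ s x * ρ ^ (-(Q x / p x))) := by ring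
      _ = C₁ * C₂ * ρ ^ diffDim Q p s x := by rw [← Real.rpow_add hρ, ← sub_eq_add_neg, diffDim]
  calc |u z - u w| ≤ dist z w ^ s z * h z ^ (1 / p z) + dist z w ^ s w * h w ^ (1 / p w) :=
        hu.abs_sub_le z hz w hw
    _ ≤ C₁ * C₂ * ρ ^ diffDim Q p s x + C₁ * C₂ * ρ ^ diffDim Q p s x :=
        add_le_add (hterm z hxz hhz) (hterm w hxw hhw)
    _ = 2 * (C₁ * C₂) * ρ ^ diffDim Q p s x := by ring

end Step

/-- The sum `1 + θ + θ² + ⋯` with `θ = 2 ^ (-1 / hi)`: the radii of a chain decay geometrically with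
ratio at most `θ`, so this bounds the length of the chain relative to its largest radius. -/
noncomputable def chainRatio (hi : ℝ) : ℝ := (1 - (2 : ℝ) ^ (-1 / hi))⁻¹

lemma two_rpow_neg_one_div_lt_one {t : ℝ} (ht : 0 < t) : (2 : ℝ) ^ (-1 / t) < 1 :=
  Real.rpow_lt_one_of_one_lt_of_neg one_lt_two (div_neg_of_neg_of_pos (by norm_num) ht)

lemma one_le_chainRatio {hi : ℝ} (h : 0 < hi) : 1 ≤ chainRatio hi := by
  have h1 := two_rpow_neg_one_div_lt_one h
  have h2 : (0 : ℝ) < 2 ^ (-1 / hi) := by positivity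
  rw [chainRatio, one_le_inv₀ (by linarith)]
  linarith

lemma chainRatio_mul_add_one_le {t hi : ℝ} (ht : 0 < t) (h : t ≤ hi) :
    chainRatio hi * 2 ^ (-1 / t) + 1 ≤ chainRatio hi := by
  have hlt := two_rpow_neg_one_div_lt_one (ht.trans_le h)
  have hle : (2 : ℝ) ^ (-1 / t) ≤ 2 ^ (-1 / hi) := by
    apply Real.rpow_le_rpow_of_exponent_le one_le_two
    rw [neg_div, neg_div]
    exact neg_le_neg (one_div_le_one_div_of_le ht h)
  have hinv : chainRatio hi * (1 - (2 : ℝ) ^ (-1 / hi)) = 1 := inv_mul_cancel₀ (by linarith)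
  nlinarith [one_le_chainRatio (ht.trans_le h)]

lemma mul_two_rpow_pow_rpow {ρ t : ℝ} (hρ : 0 < ρ) (β : ℝ) (J : ℕ) :
    (ρ * (2 ^ (-1 / t)) ^ J) ^ β = ρ ^ β * (2 ^ (-β / t)) ^ J := by
  rw [Real.mul_rpow hρ.le (by positivity), ← Real.rpow_mul_natCast zero_le_two,
    ← Real.rpow_mul_natCast zero_le_two, ← Real.rpow_mul zero_le_two]
  ring_nf

lemma mul_two_rpow_pow_rpow_neg {ρ t : ℝ} (hρ : 0 < ρ) (ht : 0 < t) (J : ℕ) :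
    (ρ * (2 ^ (-1 / t)) ^ J) ^ (-t) = ρ ^ (-t) * 2 ^ J := by
  rw [mul_two_rpow_pow_rpow hρ, neg_neg, div_self ht.ne', Real.rpow_one]

lemma exists_two_pow_between {a : ℝ} (ha : 0 ≤ a) :
    ∃ J : ℕ, a ≤ 2 ^ J ∧ (2 : ℝ) ^ J ≤ 1 + 2 * a := by
  rcases le_total a 1 with h | h
  · exact ⟨0, by simpa using h, by simpa using ha⟩
  · obtain ⟨J, hJ, hJ'⟩ := exists_nat_pow_near h (one_lt_two (α := ℝ))
    exact ⟨J + 1, hJ'.le, by rw [pow_succ]; linarith⟩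

/-- The chain moves from the ball of radius `ρ 2 ^ (-J / q)` to the one of radius `ρ`, one factor
`2 ^ (1 / q)` at a time. -/
lemma exists_chain_of_step {X : Type*} [MetricSpace X] {D : Set X} {u h : X → ℝ} {x : X}
    {ρ q K Λ C β : ℝ} (hρ : 0 < ρ) (hq : 0 < q) (hK : K * 2 ^ (-1 / q) + 1 ≤ K) (hΛ : 0 ≤ Λ)
    (hmod : ∀ (y : X) (r : ℝ), 0 < r → r ≤ ρ → dist x y + r ≤ K * r →
      ∃ z ∈ D, dist y z < r ∧ h z ≤ Λ * r ^ (-q))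
    (hstep : ∀ y ∈ D, ∀ z ∈ D, ∀ r, 0 < r → r ≤ ρ → dist x y ≤ K * r → dist x z ≤ K * r →
      h y ≤ 2 * Λ * r ^ (-q) → h z ≤ 2 * Λ * r ^ (-q) → |u y - u z| ≤ C * r ^ β) (J : ℕ) :
    ∀ y ∈ D, dist x y ≤ K * (ρ * (2 ^ (-1 / q)) ^ J) → h y ≤ Λ * (ρ ^ (-q) * 2 ^ J) →
      ∃ z ∈ D, dist x z ≤ K * ρ ∧ h z ≤ Λ * ρ ^ (-q) ∧
        |u y - u z| ≤ C * (ρ ^ β * ∑ j ∈ Finset.range J, ((2 : ℝ) ^ (-β / q)) ^ j) := by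
  induction J with
  | zero =>
    intro y hy hxy hhy
    exact ⟨y, hy, by simpa using hxy, by simpa using hhy, by simp⟩
  | succ J ih =>
    intro y hy hxy hhy
    have hθ := two_rpow_neg_one_div_lt_one hq
    have hrpow := mul_two_rpow_pow_rpow_neg hρ hq J
    have hrβ := mul_two_rpow_pow_rpow (t := q) hρ β J
    rw [pow_succ] at hxy
    have hr : 0 < ρ * (2 ^ (-1 / q)) ^ J := by positivity
    have hrρ : ρ * (2 ^ (-1 / q)) ^ J ≤ ρ :=
      mul_le_of_le_one_right hρ.le (pow_le_one₀ (by positivity) hθ.le)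
    set r := ρ * (2 ^ (-1 / q)) ^ J
    have hxyr : dist x y + r ≤ K * r := by
      calc dist x y + r ≤ (K * 2 ^ (-1 / q) + 1) * r := by linarith
        _ ≤ K * r := by gcongr
    obtain ⟨w, hw, hyw, hhw⟩ := hmod y r hr hrρ hxyr
    have hxw : dist x w ≤ K * r := by linarith [dist_triangle x y w]
    obtain ⟨z, hz, hxz, hhz, huz⟩ := ih w hw hxw (by rwa [← hrpow])
    refine ⟨z, hz, hxz, hhz, ?_⟩
    have huw : |u y - u w| ≤ C * r ^ β := by
      refine hstep y hy w hw r hr hrρ (by linarith) hxw ?_ (hhw.trans ?_)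
      · rw [hrpow]
        exact hhy.trans_eq (by ring)
      · gcongr
        linarith
    rw [Finset.sum_range_succ]
    rw [hrβ] at huw
    linarith [abs_sub_le (u y) (u w) (u z)]

namespace Exponents

variable {X : Type*} [MetricSpace X] {Q p s : X → ℝ} {lo hi M : ℝ}

lemma exists_moderate_near (hE : Exponents Q p s lo hi) (hM : 1 ≤ M) (δ : ℝ) {K : ℝ}
    (hK : 0 < K) : ∃ Λ : ℝ, 1 ≤ Λ ∧ ∀ (x y : X) (ρ a : ℝ), 0 < ρ → ρ ≤ δ → dist x y ≤ K * ρ →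
      a ≤ M * ρ ^ (-Q y) → a ≤ Λ * ρ ^ (-Q x) := by
  obtain ⟨C, hC, hQ⟩ := hE.logHolder_Q.neg.rpow_le (R := δ) hK
  refine ⟨M * C, one_le_mul_of_one_le_of_one_le hM hC, fun x y ρ a hρ hρδ hxy ha => ?_⟩
  calc a ≤ M * ρ ^ (-Q y) := ha
    _ ≤ M * (C * ρ ^ (-Q x)) := by
      gcongr
      exact hQ y x ρ hρ hρδ (by rwa [dist_comm])
    _ = M * C * ρ ^ (-Q x) := by ring

lemma exists_chain (hE : Exponents Q p s lo hi) (hM : 1 ≤ M) (δ : ℝ) :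
    ∃ Λ C : ℝ, 1 ≤ Λ ∧ 0 < C ∧ ∀ (U D : Set X) (u h : X → ℝ), IsScalarGradient p s D u h →
      HasModerateValues Q M δ U D h →
      ∀ x ∈ D, ∀ ρ, 0 < ρ → ρ ≤ δ → ball x (chainRatio hi * ρ) ⊆ U →
      ∃ z ∈ D, ∃ J : ℕ, dist x z ≤ chainRatio hi * ρ ∧ h z ≤ Λ * ρ ^ (-Q x) ∧
        (2 : ℝ) ^ J ≤ 1 + 2 * (h x * ρ ^ Q x) ∧
        |u x - u z| ≤ C * (ρ ^ diffDim Q p s x *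
          ∑ j ∈ Finset.range J, ((2 : ℝ) ^ (-diffDim Q p s x / Q x)) ^ j) := by
  rcases isEmpty_or_nonempty X with hX | ⟨⟨x₁⟩⟩
  · exact ⟨1, 1, le_rfl, one_pos, fun U D u h _ _ x => hX.elim x⟩
  have hK : 1 ≤ chainRatio hi := one_le_chainRatio (hE.hi_pos x₁)
  obtain ⟨Λ, hΛ, hnear⟩ := hE.exists_moderate_near hM δ (K := chainRatio hi) (by positivity)
  obtain ⟨C, hC, hstep⟩ := hE.abs_sub_le_rpow_diffDim hK (A := 2 * Λ) (by linarith) δ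
  refine ⟨Λ, C, hΛ, hC, fun U D u h hu hmod x hxD ρ hρ hρδ hU => ?_⟩
  have hhx := hu.nonneg x
  obtain ⟨J, hJ, hJ'⟩ := exists_two_pow_between (a := h x * ρ ^ Q x) (by positivity)
  have hhJ : h x ≤ Λ * (ρ ^ (-Q x) * 2 ^ J) := by
    calc h x = ρ ^ (-Q x) * (h x * ρ ^ Q x) := by
          rw [mul_left_comm, ← Real.rpow_add hρ, neg_add_cancel, Real.rpow_zero, mul_one]
      _ ≤ ρ ^ (-Q x) * 2 ^ J := by gcongr
      _ ≤ Λ * (ρ ^ (-Q x) * 2 ^ J) := le_mul_of_one_le_left (by positivity) hΛ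
  obtain ⟨z, hz, hxz, hhz, huz⟩ := exists_chain_of_step (K := chainRatio hi) (u := u)
    (β := diffDim Q p s x) hρ (hE.Q_pos x)
    (chainRatio_mul_add_one_le (hE.Q_pos x) (hE.Q_mem x).2) (by positivity)
    (fun y r hr hrρ hxy => by
      have hsub : ball y r ⊆ ball x (chainRatio hi * ρ) := ball_subset_ball' (by
        rw [dist_comm, add_comm]
        exact hxy.trans (by gcongr))
      obtain ⟨w, hw, hyw, hhw⟩ := hmod y r hr (hrρ.trans hρδ) (hsub.trans hU)
      exact ⟨w, hw, hyw, hnear x y r _ hr (hrρ.trans hρδ) (by linarith) hhw⟩)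
    (fun y hy w hw r hr hrρ hxy hxw hhy hhw =>
      hstep D u h hu x y w r hr (hrρ.trans hρδ) hy hw hxy hxw hhy hhw)
    J x hxD (by rw [dist_self]; positivity) hhJ
  exact ⟨z, hz, J, hxz, hhz, hJ', huz⟩

/-- The common form of the three embeddings: the sign of `diffDim` decides how the geometric sum
depends on `J`, that is, on `h x`. -/
lemma abs_sub_le_geom_sum (hE : Exponents Q p s lo hi) (hM : 1 ≤ M) (δ : ℝ) {L : ℝ}
    (hL : chainRatio hi ≤ L) :
    ∃ C : ℝ, 0 < C ∧ ∀ (U D : Set X) (u h : X → ℝ), IsScalarGradient p s D u h →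
      HasModerateValues Q M δ U D h →
      ∀ x ∈ D, ∀ w ∈ D, ∀ (y : X) (ρ : ℝ), 0 < ρ → ρ ≤ δ → ball x (chainRatio hi * ρ) ⊆ U →
      dist x y ≤ L * ρ → dist x w ≤ L * ρ → h w ≤ M * ρ ^ (-Q y) →
      ∃ J : ℕ, (2 : ℝ) ^ J ≤ 1 + 2 * (h x * ρ ^ Q x) ∧
        |u x - u w| ≤ C * (ρ ^ diffDim Q p s x *
          (1 + ∑ j ∈ Finset.range J, ((2 : ℝ) ^ (-diffDim Q p s x / Q x)) ^ j)) := by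
  rcases isEmpty_or_nonempty X with hX | ⟨⟨x₁⟩⟩
  · exact ⟨1, one_pos, fun U D u h _ _ x => hX.elim x⟩
  have hL1 : 1 ≤ L := (one_le_chainRatio (hE.hi_pos x₁)).trans hL
  obtain ⟨Λ, C₁, hΛ, hC₁, hchain⟩ := hE.exists_chain hM δ
  obtain ⟨Λ', -, hnear⟩ := hE.exists_moderate_near hM δ (K := L) (by positivity)
  obtain ⟨C₂, -, hstep⟩ := hE.abs_sub_le_rpow_diffDim hL1 (A := max Λ Λ')
    (hΛ.trans (le_max_left _ _)) δ
  refine ⟨max C₁ C₂, by positivity,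
    fun U D u h hu hmod x hx w hw y ρ hρ hρδ hU hxy hxw hhw => ?_⟩
  obtain ⟨z, hz, J, hxz, hhz, hJ, huz⟩ := hchain U D u h hu hmod x hx ρ hρ hρδ hU
  refine ⟨J, hJ, ?_⟩
  have hzw : |u z - u w| ≤ C₂ * ρ ^ diffDim Q p s x := by
    refine hstep D u h hu x z w ρ hρ hρδ hz hw (hxz.trans (by gcongr)) hxw (hhz.trans ?_)
      ((hnear x y ρ _ hρ hρδ hxy hhw).trans ?_)
    · gcongr
      exact le_max_left _ _
    · gcongr
      exact le_max_right _ _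
  set S := ∑ j ∈ Finset.range J, ((2 : ℝ) ^ (-diffDim Q p s x / Q x)) ^ j
  have hS : 0 ≤ S := Finset.sum_nonneg fun _ _ => by positivity
  calc |u x - u w| ≤ |u x - u z| + |u z - u w| := abs_sub_le _ _ _
    _ ≤ C₁ * (ρ ^ diffDim Q p s x * S) + C₂ * ρ ^ diffDim Q p s x := add_le_add huz hzw
    _ ≤ max C₁ C₂ * (ρ ^ diffDim Q p s x * S) + max C₁ C₂ * ρ ^ diffDim Q p s x := by
        gcongr
        exacts [le_max_left _ _, le_max_right _ _]
    _ = max C₁ C₂ * (ρ ^ diffDim Q p s x * (1 + S)) := by ring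

end Exponents

/-! ### Pointwise estimates -/

lemma one_add_geom_sum_le_mul_pow {τ τ₀ : ℝ} (hτ₀ : 1 < τ₀) (h : τ₀ ≤ τ) (J : ℕ) :
    1 + ∑ j ∈ Finset.range J, τ ^ j ≤ (1 + 1 / (τ₀ - 1)) * τ ^ J := by
  have hpow : 1 ≤ τ ^ J := one_le_pow₀ (by linarith)
  have : 0 < τ₀ - 1 := by linarith
  have hquot : (τ ^ J - 1) / (τ - 1) ≤ τ ^ J / (τ₀ - 1) := by gcongr; linarith
  rw [geom_sum_eq (by linarith), add_mul, one_mul, one_div_mul_eq_div]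
  linarith

lemma geom_sum_le_inv_one_sub {τ τ₀ : ℝ} (hτ : 0 ≤ τ) (h : τ ≤ τ₀) (hτ₀ : τ₀ < 1) (J : ℕ) :
    ∑ j ∈ Finset.range J, τ ^ j ≤ (1 - τ₀)⁻¹ := by
  calc ∑ j ∈ Finset.range J, τ ^ j ≤ ∑' j, τ ^ j :=
        (summable_geometric_of_lt_one hτ (h.trans_lt hτ₀)).sum_le_tsum _
          fun _ _ => by positivity
    _ = (1 - τ)⁻¹ := tsum_geometric_of_lt_one hτ (h.trans_lt hτ₀)
    _ ≤ _ := inv_anti₀ (by linarith) (by linarith)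

lemma rpow_le_of_le_geom_sum {t r a C q γ γ₁ : ℝ} {J : ℕ} (ht : 0 ≤ t) (hr : 0 < r) (hC : 0 ≤ C)
    (hγ : 0 < γ) (hγ₁ : γ ≤ γ₁)
    (h : t ≤ C * (r ^ (-(q / γ)) * (1 + ∑ j ∈ Finset.range J, ((2 : ℝ) ^ (1 / γ)) ^ j)))
    (hJ : (2 : ℝ) ^ J ≤ 1 + 2 * (a * r ^ q)) :
    t ^ γ ≤ max 1 (C * (1 + 1 / (2 ^ (1 / γ₁) - 1))) ^ γ₁ * (r ^ (-q) + 2 * a) := by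
  have hτ₀ : (1 : ℝ) < 2 ^ (1 / γ₁) :=
    Real.one_lt_rpow one_lt_two (one_div_pos.2 (hγ.trans_le hγ₁))
  have hτ : (2 : ℝ) ^ (1 / γ₁) ≤ 2 ^ (1 / γ) :=
    Real.rpow_le_rpow_of_exponent_le one_le_two (one_div_le_one_div_of_le hγ hγ₁)
  have : (0 : ℝ) < 2 ^ (1 / γ₁) - 1 := by linarith
  set G := 1 + 1 / ((2 : ℝ) ^ (1 / γ₁) - 1)
  have : 0 < G := by positivity
  have ht' : t ≤ C * G * (r ^ (-q) * 2 ^ J) ^ (1 / γ) := by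
    calc t ≤ C * (r ^ (-(q / γ)) * (G * ((2 : ℝ) ^ (1 / γ)) ^ J)) := by
          refine h.trans ?_
          gcongr
          exact one_add_geom_sum_le_mul_pow hτ₀ hτ J
      _ = C * G * (r ^ (-q) * 2 ^ J) ^ (1 / γ) := by
          rw [Real.mul_rpow (by positivity) (by positivity), ← Real.rpow_mul hr.le, neg_mul,
            mul_one_div, Real.rpow_pow_comm zero_le_two]
          ring
  have hmass : r ^ (-q) * 2 ^ J ≤ r ^ (-q) + 2 * a := by
    calc r ^ (-q) * 2 ^ J ≤ r ^ (-q) * (1 + 2 * (a * r ^ q)) := by gcongr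
      _ = r ^ (-q) + 2 * a * (r ^ (-q) * r ^ q) := by ring
      _ = r ^ (-q) + 2 * a := by
          rw [← Real.rpow_add hr, neg_add_cancel, Real.rpow_zero, mul_one]
  calc t ^ γ ≤ (C * G * (r ^ (-q) * 2 ^ J) ^ (1 / γ)) ^ γ := by gcongr
    _ = (C * G) ^ γ * (r ^ (-q) * 2 ^ J) := by
        rw [Real.mul_rpow (by positivity) (by positivity), ← Real.rpow_mul (by positivity),
          one_div_mul_cancel hγ.ne', Real.rpow_one]
    _ ≤ max 1 (C * G) ^ γ * (r ^ (-q) * 2 ^ J) := by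
        gcongr
        exact le_max_right _ _
    _ ≤ max 1 (C * G) ^ γ₁ * (r ^ (-q) + 2 * a) := by
        gcongr
        exact le_max_left _ _

lemma exists_chain_ball_subset {hi σ : ℝ} (hhi : 0 < hi) (hσ : 1 < σ) {X : Type*}
    [MetricSpace X] : ∃ η : ℝ, 0 < η ∧ η ≤ 1 ∧ ∀ (x₀ x : X) (r₀ ρ : ℝ), x ∈ ball x₀ r₀ →
      ρ ≤ η * r₀ → ball x (chainRatio hi * ρ) ⊆ ball x₀ (σ * r₀) := by
  have hK : 0 < chainRatio hi := one_pos.trans_le (one_le_chainRatio hhi)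
  have : 0 < σ - 1 := by linarith
  refine ⟨min 1 ((σ - 1) / chainRatio hi), by positivity, min_le_left _ _,
    fun x₀ x r₀ ρ hx hρ => ball_subset_ball' ?_⟩
  have hr : 0 < r₀ := pos_of_mem_ball hx
  have hρ' : ρ ≤ (σ - 1) / chainRatio hi * r₀ := hρ.trans (by gcongr; exact min_le_right _ _)
  have hlength : chainRatio hi * ρ ≤ (σ - 1) * r₀ := by
    rwa [div_mul_eq_mul_div, le_div_iff₀' hK] at hρ'
  linarith [mem_ball.1 hx]

namespace Exponents

variable {X : Type*} [MetricSpace X] {Q p s : X → ℝ} {lo hi M δ σ : ℝ}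

lemma neg_div_le_diffDim (hE : Exponents Q p s lo hi) (x : X) : -(hi / lo) ≤ diffDim Q p s x := by
  have hs := hE.s_pos x
  have hQp : Q x / p x ≤ hi / lo :=
    div_le_div₀ (hE.hi_pos x).le (hE.Q_mem x).2 hE.lo_pos (hE.p_mem x).1
  rw [diffDim]
  linarith

lemma exists_abs_sub_le_geom_sum (hE : Exponents Q p s lo hi) (hM : 1 ≤ M) (δ : ℝ) (hσ : 1 < σ) :
    ∃ C : ℝ, 0 < C ∧ ∀ (D : Set X) (u h : X → ℝ) (x₀ : X) (r₀ : ℝ), 0 < r₀ → r₀ ≤ δ →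
      IsScalarGradient p s D u h → HasModerateValues Q M δ (ball x₀ (σ * r₀)) D h →
      ∃ a : ℝ, ∀ x ∈ D, x ∈ ball x₀ r₀ → ∃ J : ℕ, (2 : ℝ) ^ J ≤ 1 + 2 * (h x * r₀ ^ Q x) ∧
        |u x - a| ≤ C * (r₀ ^ diffDim Q p s x *
          (1 + ∑ j ∈ Finset.range J, ((2 : ℝ) ^ (-diffDim Q p s x / Q x)) ^ j)) := by
  rcases isEmpty_or_nonempty X with hX | ⟨⟨x₁⟩⟩
  · exact ⟨1, one_pos, fun D u h x => hX.elim x⟩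
  obtain ⟨η, hη, hη1, hsub⟩ := exists_chain_ball_subset (hE.hi_pos x₁) hσ (X := X)
  have hK : 1 ≤ chainRatio hi := one_le_chainRatio (hE.hi_pos x₁)
  have hη' : 0 < 2 / η := by positivity
  obtain ⟨C, hC, hosc⟩ := hE.abs_sub_le_geom_sum hM δ
    (le_add_of_nonneg_right hη'.le : chainRatio hi ≤ chainRatio hi + 2 / η)
  refine ⟨C * η ^ (-(hi / lo)), by positivity, fun D u h x₀ r₀ hr hrδ hu hmod => ?_⟩
  have hρ : 0 < η * r₀ := by positivity
  have hρr : η * r₀ ≤ r₀ := mul_le_of_le_one_left hr.le hη1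
  have hρδ : η * r₀ ≤ δ := hρr.trans hrδ
  have hL : 2 * r₀ ≤ (chainRatio hi + 2 / η) * (η * r₀) := by
    have : 2 / η * (η * r₀) = 2 * r₀ := by field_simp
    nlinarith
  obtain ⟨w, hw, hxw, hhw⟩ := hmod x₀ (η * r₀) hρ hρδ
    ((ball_subset_ball (by nlinarith)).trans (hsub x₀ x₀ r₀ _ (mem_ball_self hr) le_rfl))
  refine ⟨u w, fun x hx hxB => ?_⟩
  have hxx₀ := mem_ball.1 hxB
  obtain ⟨J, hJ, hxJ⟩ := hosc _ D u h hu hmod x hx w hw x₀ _ hρ hρδ (hsub x₀ x r₀ _ hxB le_rfl)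
    (by linarith) (by linarith [dist_triangle x x₀ w]) hhw
  have hhx := hu.nonneg x
  refine ⟨J, hJ.trans (by gcongr; exact (hE.Q_pos x).le), hxJ.trans ?_⟩
  have hS : 0 ≤ ∑ j ∈ Finset.range J, ((2 : ℝ) ^ (-diffDim Q p s x / Q x)) ^ j :=
    Finset.sum_nonneg fun _ _ => by positivity
  rw [mul_assoc, Real.mul_rpow hη.le hr.le, mul_assoc]
  gcongr C * (?_ * _)
  exact Real.rpow_le_rpow_of_exponent_ge hη hη1 (hE.neg_div_le_diffDim x)

lemma sobolevExponent_mem (hE : Exponents Q p s lo hi) {c : ℝ} (hc : 0 < c)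
    (hα : ∀ x, diffDim Q p s x ≤ -c) (x : X) : sobolevExponent Q p s x ∈ Icc lo (hi / c) := by
  have hneg : c ≤ -diffDim Q p s x := le_neg.1 (hα x)
  rw [hE.sobolevExponent_eq_div]
  constructor
  · have hdim : -diffDim Q p s x ≤ Q x / p x := by
      rw [diffDim]
      linarith [hE.s_pos x]
    refine (hE.p_mem x).1.trans ?_
    rwa [le_div_comm₀ (hE.p_pos x) (hc.trans_le hneg)]
  · exact div_le_div₀ (hE.hi_pos x).le (hE.Q_mem x).2 hc hneg

lemma sobolev_pointwise (hE : Exponents Q p s lo hi) (hM : 1 ≤ M) (δ : ℝ) (hσ : 1 < σ) {c : ℝ}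
    (hc : 0 < c) (hα : ∀ x, diffDim Q p s x ≤ -c) :
    ∃ C : ℝ, 1 ≤ C ∧ ∀ (D : Set X) (u h : X → ℝ) (x₀ : X) (r₀ : ℝ), 0 < r₀ → r₀ ≤ δ →
      IsScalarGradient p s D u h → HasModerateValues Q M δ (ball x₀ (σ * r₀)) D h →
      ∃ a : ℝ, ∀ x ∈ D, x ∈ ball x₀ r₀ →
        |u x - a| ^ sobolevExponent Q p s x ≤ C * (r₀ ^ (-Q x₀) + h x) := by
  obtain ⟨C₁, hC₁, hcenter⟩ := hE.exists_abs_sub_le_geom_sum hM δ hσ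
  obtain ⟨C₂, hC₂, hQ⟩ := hE.logHolder_Q.neg.rpow_le (R := δ) one_pos
  rcases isEmpty_or_nonempty X with hX | ⟨⟨x₁⟩⟩
  · exact ⟨1, le_rfl, fun D u h x => hX.elim x⟩
  have hhi := hE.hi_pos x₁
  set C₃ := max 1 (C₁ * (1 + 1 / (2 ^ (1 / (hi / c)) - 1))) ^ (hi / c)
  have hC₃ : 1 ≤ C₃ := Real.one_le_rpow (le_max_left _ _) (by positivity)
  refine ⟨C₃ * (C₂ + 2), by nlinarith, fun D u h x₀ r₀ hr hrδ hu hmod => ?_⟩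
  obtain ⟨a, ha⟩ := hcenter D u h x₀ r₀ hr hrδ hu hmod
  refine ⟨a, fun x hx hxB => ?_⟩
  obtain ⟨J, hJ, hux⟩ := ha x hx hxB
  have hQx := hE.Q_pos x
  obtain ⟨hγlo, hγhi⟩ := hE.sobolevExponent_mem hc hα x
  have hγ := hE.sobolevExponent_eq_div x
  have hratio : -diffDim Q p s x / Q x = 1 / sobolevExponent Q p s x := by rw [hγ, one_div_div]
  have hdim : diffDim Q p s x = -(Q x / sobolevExponent Q p s x) := by
    rw [hγ, div_div_cancel₀ hQx.ne', neg_neg]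
  rw [hratio, hdim] at hux
  have hrQ : r₀ ^ (-Q x) ≤ C₂ * r₀ ^ (-Q x₀) :=
    hQ x x₀ r₀ hr hrδ (by rw [one_mul]; exact (mem_ball.1 hxB).le)
  have hhx := hu.nonneg x
  calc |u x - a| ^ sobolevExponent Q p s x ≤ C₃ * (r₀ ^ (-Q x) + 2 * h x) :=
        rpow_le_of_le_geom_sum (abs_nonneg _) hr hC₁.le (hE.lo_pos.trans_le hγlo) hγhi hux hJ
    _ ≤ C₃ * ((C₂ + 2) * (r₀ ^ (-Q x₀) + h x)) := by
        gcongr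
        have : 0 < r₀ ^ (-Q x₀) := by positivity
        nlinarith
    _ = C₃ * (C₂ + 2) * (r₀ ^ (-Q x₀) + h x) := by ring

lemma moserTrudinger_pointwise (hE : Exponents Q p s lo hi) (hM : 1 ≤ M) (δ : ℝ) (hσ : 1 < σ)
    (hα : ∀ x, diffDim Q p s x = 0) :
    ∃ c C : ℝ, 0 < c ∧ 0 < C ∧ ∀ (D : Set X) (u h : X → ℝ) (x₀ : X) (r₀ : ℝ), 0 < r₀ → r₀ ≤ δ →
      IsScalarGradient p s D u h → HasModerateValues Q M δ (ball x₀ (σ * r₀)) D h →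
      ∃ a : ℝ, ∀ x ∈ D, x ∈ ball x₀ r₀ →
        Real.exp (c * |u x - a|) ≤ C * (1 + h x * r₀ ^ Q x₀) := by
  obtain ⟨C₁, hC₁, hcenter⟩ := hE.exists_abs_sub_le_geom_sum hM δ hσ
  obtain ⟨C₂, hC₂, hQ⟩ := hE.logHolder_Q.rpow_le (R := δ) one_pos
  have : 0 < Real.log 2 := Real.log_pos one_lt_two
  refine ⟨Real.log 2 / C₁, 4 * C₂, by positivity, by positivity,
    fun D u h x₀ r₀ hr hrδ hu hmod => ?_⟩
  obtain ⟨a, ha⟩ := hcenter D u h x₀ r₀ hr hrδ hu hmod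
  refine ⟨a, fun x hx hxB => ?_⟩
  obtain ⟨J, hJ, hux⟩ := ha x hx hxB
  simp only [hα, Real.rpow_zero, neg_zero, zero_div, one_pow, Finset.sum_const, Finset.card_range,
    nsmul_eq_mul, mul_one, one_mul] at hux
  have hlinear : Real.log 2 / C₁ * |u x - a| ≤ Real.log 2 * (J + 1 : ℕ) := by
    calc Real.log 2 / C₁ * |u x - a| ≤ Real.log 2 / C₁ * (C₁ * (1 + J)) := by gcongr
      _ = Real.log 2 * (J + 1 : ℕ) := by push_cast; field_simp; ring
  have hrQ : r₀ ^ Q x ≤ C₂ * r₀ ^ Q x₀ :=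
    hQ x x₀ r₀ hr hrδ (by rw [one_mul]; exact (mem_ball.1 hxB).le)
  have hhx := hu.nonneg x
  calc Real.exp (Real.log 2 / C₁ * |u x - a|) ≤ Real.exp (Real.log 2 * (J + 1 : ℕ)) :=
        Real.exp_le_exp.2 hlinear
    _ = 2 * 2 ^ J := by rw [← Real.rpow_def_of_pos two_pos, Real.rpow_natCast, pow_succ']
    _ ≤ 2 * (1 + 2 * (h x * (C₂ * r₀ ^ Q x₀))) := by
        gcongr
        exact hJ.trans (by gcongr)
    _ ≤ 4 * C₂ * (1 + h x * r₀ ^ Q x₀) := by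
        have : 0 ≤ h x * r₀ ^ Q x₀ := by positivity
        nlinarith

lemma abs_sub_le_of_le_diffDim (hE : Exponents Q p s lo hi) (hM : 1 ≤ M) (δ : ℝ) {L c : ℝ}
    (hL : chainRatio hi ≤ L) (hc : 0 < c) (hα : ∀ x, c ≤ diffDim Q p s x) :
    ∃ C : ℝ, 0 < C ∧ ∀ (U D : Set X) (u h : X → ℝ), IsScalarGradient p s D u h →
      HasModerateValues Q M δ U D h →
      ∀ x ∈ D, ∀ w ∈ D, ∀ (y : X) (ρ : ℝ), 0 < ρ → ρ ≤ δ → ball x (chainRatio hi * ρ) ⊆ U →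
      dist x y ≤ L * ρ → dist x w ≤ L * ρ → h w ≤ M * ρ ^ (-Q y) →
      |u x - u w| ≤ C * ρ ^ diffDim Q p s x := by
  obtain ⟨C, hC, hosc⟩ := hE.abs_sub_le_geom_sum hM δ hL
  rcases isEmpty_or_nonempty X with hX | ⟨⟨x₁⟩⟩
  · exact ⟨1, one_pos, fun U D u h _ _ x => hX.elim x⟩
  have hhi := hE.hi_pos x₁
  set τ₀ : ℝ := 2 ^ (-(c / hi))
  have hτ₀ : τ₀ < 1 :=
    Real.rpow_lt_one_of_one_lt_of_neg one_lt_two (neg_lt_zero.2 (by positivity))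
  have : 0 < (1 - τ₀)⁻¹ := inv_pos.2 (by linarith)
  refine ⟨C * (1 + (1 - τ₀)⁻¹), by positivity,
    fun U D u h hu hmod x hx w hw y ρ hρ hρδ hU hxy hxw hhw => ?_⟩
  obtain ⟨J, -, hxJ⟩ := hosc U D u h hu hmod x hx w hw y ρ hρ hρδ hU hxy hxw hhw
  have hτ : (2 : ℝ) ^ (-diffDim Q p s x / Q x) ≤ τ₀ := by
    apply Real.rpow_le_rpow_of_exponent_le one_le_two
    rw [neg_div, neg_le_neg_iff]
    exact div_le_div₀ (hc.le.trans (hα x)) (hα x) (hE.Q_pos x) (hE.Q_mem x).2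
  calc |u x - u w| ≤ C * (ρ ^ diffDim Q p s x * (1 + (1 - τ₀)⁻¹)) := by
        refine hxJ.trans ?_
        gcongr
        exact geom_sum_le_inv_one_sub (by positivity) hτ hτ₀ J
    _ = C * (1 + (1 - τ₀)⁻¹) * ρ ^ diffDim Q p s x := by ring

lemma abs_sub_le_of_dist_le_mul (hE : Exponents Q p s lo hi) (hM : 1 ≤ M) (δ : ℝ) {c K : ℝ}
    (hc : 0 < c) (hα : ∀ x, c ≤ diffDim Q p s x) (hK : 0 < K) :
    ∃ C : ℝ, 0 < C ∧ ∀ (U D : Set X) (u h : X → ℝ), IsScalarGradient p s D u h →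
      HasModerateValues Q M δ U D h →
      ∀ x ∈ D, ∀ y ∈ D, ∀ ρ : ℝ, 0 < ρ → ρ ≤ δ → dist x y ≤ K * ρ →
      ball x (chainRatio hi * ρ) ⊆ U → ball y (chainRatio hi * ρ) ⊆ U →
      |u x - u y| ≤ C * ρ ^ diffDim Q p s x := by
  rcases isEmpty_or_nonempty X with hX | ⟨⟨x₁⟩⟩
  · exact ⟨1, one_pos, fun U D u h _ _ x => hX.elim x⟩
  have hL : 1 ≤ chainRatio hi := one_le_chainRatio (hE.hi_pos x₁)
  obtain ⟨C, hC, hosc⟩ := hE.abs_sub_le_of_le_diffDim hM δ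
    (le_add_of_nonneg_right hK.le : chainRatio hi ≤ chainRatio hi + K) hc hα
  obtain ⟨B, hB, hαy⟩ := hE.logHolder_diffDim.rpow_le (R := δ) hK
  refine ⟨C * (1 + B), by positivity, fun U D u h hu hmod x hx y hy ρ hρ hρδ hxy hxU hyU => ?_⟩
  obtain ⟨w, hw, hxw, hhw⟩ := hmod x ρ hρ hρδ ((ball_subset_ball (by nlinarith)).trans hxU)
  have hρL : ρ ≤ chainRatio hi * ρ := le_mul_of_one_le_left hρ.le hL
  have hKρ : 0 < K * ρ := mul_pos hK hρ
  rw [dist_comm] at hxy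
  have hux : |u x - u w| ≤ C * ρ ^ diffDim Q p s x :=
    hosc U D u h hu hmod x hx w hw x ρ hρ hρδ hxU (by rw [dist_self]; positivity)
      (by linarith) hhw
  have huy : |u y - u w| ≤ C * ρ ^ diffDim Q p s y :=
    hosc U D u h hu hmod y hy w hw x ρ hρ hρδ hyU (by linarith)
      (by linarith [dist_triangle y x w]) hhw
  have hρy : ρ ^ diffDim Q p s y ≤ B * ρ ^ diffDim Q p s x := hαy y x ρ hρ hρδ hxy
  calc |u x - u y| ≤ |u x - u w| + |u y - u w| := by
        rw [abs_sub_comm (u y)]; exact abs_sub_le _ _ _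
    _ ≤ C * ρ ^ diffDim Q p s x + C * (B * ρ ^ diffDim Q p s x) :=
        add_le_add hux (huy.trans (by gcongr))
    _ = C * (1 + B) * ρ ^ diffDim Q p s x := by ring

lemma morrey_pointwise (hE : Exponents Q p s lo hi) (hM : 1 ≤ M) (δ : ℝ) (hσ : 1 < σ) {c : ℝ}
    (hc : 0 < c) (hα : ∀ x, c ≤ diffDim Q p s x) :
    ∃ C : ℝ, 0 < C ∧ ∀ (D : Set X) (u h : X → ℝ) (x₀ : X) (r₀ : ℝ), r₀ ≤ δ →
      IsScalarGradient p s D u h → HasModerateValues Q M δ (ball x₀ (σ * r₀)) D h →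
      ∀ x ∈ D, x ∈ ball x₀ r₀ → ∀ y ∈ D, y ∈ ball x₀ r₀ →
        |u x - u y| ≤ C * dist x y ^ diffDim Q p s x := by
  rcases isEmpty_or_nonempty X with hX | ⟨⟨x₁⟩⟩
  · exact ⟨1, one_pos, fun D u h x => hX.elim x⟩
  obtain ⟨η, hη, hη1, hsub⟩ := exists_chain_ball_subset (hE.hi_pos x₁) hσ (X := X)
  obtain ⟨C, hC, hosc⟩ := hE.abs_sub_le_of_dist_le_mul hM δ hc hα (div_pos two_pos hη)
  refine ⟨C, hC, fun D u h x₀ r₀ hrδ hu hmod x hx hxB y hy hyB => ?_⟩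
  rcases eq_or_ne x y with rfl | hne
  · rw [sub_self, abs_zero]
    positivity
  have hd : 0 < dist x y := dist_pos.2 hne
  have hd2 : dist x y < 2 * r₀ := by
    linarith [dist_triangle_right x y x₀, mem_ball.1 hxB, mem_ball.1 hyB]
  have hρr : η / 2 * dist x y ≤ η * r₀ := by nlinarith
  have hρδ : η / 2 * dist x y ≤ δ :=
    hρr.trans ((mul_le_of_le_one_left (pos_of_mem_ball hxB).le hη1).trans hrδ)
  calc |u x - u y| ≤ C * (η / 2 * dist x y) ^ diffDim Q p s x :=
        hosc _ D u h hu hmod x hx y hy _ (by positivity) hρδ (by field_simp; rfl)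
          (hsub x₀ x r₀ _ hxB hρr) (hsub x₀ y r₀ _ hyB hρr)
    _ ≤ C * dist x y ^ diffDim Q p s x := by
        gcongr
        · exact hc.le.trans (hα x)
        · exact mul_le_of_le_one_left hd.le (by linarith)

end Exponents

/-! ### Reduction to a scalar gradient -/

lemma iSup_le_seqNorm {q : ℝ≥0∞} (hq : 0 < q) (a : ℤ → ℝ≥0∞) : ⨆ k, a k ≤ seqNorm q a := by
  unfold seqNorm
  split_ifs with h
  · exact le_rfl
  · have hq' : 0 < q.toReal := ENNReal.toReal_pos hq.ne' h
    refine iSup_le fun k => ?_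
    calc a k = (a k ^ q.toReal) ^ (1 / q.toReal) := by
          rw [← ENNReal.rpow_mul, mul_one_div_cancel hq'.ne', ENNReal.rpow_one]
      _ ≤ _ := ENNReal.rpow_le_rpow (ENNReal.le_tsum k) (by positivity)

lemma ennreal_inv_add_one_mul_le_one (S : ℝ≥0∞) : (S + 1)⁻¹ * S ≤ 1 := by
  rw [mul_comm, ← div_eq_mul_inv]
  exact ENNReal.div_le_of_le_mul (by rw [one_mul]; exact le_self_add)

section MixedNorm

variable {X : Type*} [MeasurableSpace X] {μ : Measure X} {E : Set X} {p : X → ℝ} {q : X → ℝ≥0∞}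

lemma modular_mono_ae (hp : ∀ x, 0 < p x) {f g : X → ℝ≥0∞} (h : ∀ᵐ x ∂μ.restrict E, f x ≤ g x) :
    modular μ E p f ≤ modular μ E p g :=
  lintegral_mono_ae (h.mono fun x hx => ENNReal.rpow_le_rpow hx (hp x).le)

lemma luxNorm_lt_top {lo : ℝ} (hlo : 0 < lo) (hp : ∀ x, lo ≤ p x) {f : X → ℝ≥0∞}
    (h : modular μ E p f < ∞) : luxNorm μ E p f < ∞ := by
  set S := modular μ E p f
  have hS1 : (1 : ℝ≥0∞) ≤ S + 1 := le_add_self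
  set t := (S + 1) ^ (1 / lo) with ht
  have ht1 : 1 ≤ t := ENNReal.one_le_rpow hS1 (by positivity)
  have htop : t < ∞ := ENNReal.rpow_lt_top_of_nonneg (by positivity) (by finiteness)
  refine lt_of_le_of_lt (sInf_le ⟨one_pos.trans_le ht1, htop, ?_⟩) htop
  have hpow : ∀ x, S + 1 ≤ t ^ p x := fun x => by
    calc S + 1 = t ^ lo := by
          rw [ht, ← ENNReal.rpow_mul, one_div_mul_cancel hlo.ne', ENNReal.rpow_one]
      _ ≤ t ^ p x := ENNReal.rpow_le_rpow_of_exponent_le ht1 (hp x)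
  calc modular μ E p (fun x => f x / t) ≤ ∫⁻ x in E, (S + 1)⁻¹ * f x ^ p x ∂μ := by
        refine lintegral_mono fun x => ?_
        dsimp only
        rw [ENNReal.div_rpow_of_nonneg _ _ (hlo.le.trans (hp x)), mul_comm, div_eq_mul_inv]
        gcongr
        exact hpow x
    _ = (S + 1)⁻¹ * S := lintegral_const_mul' _ _ (ENNReal.inv_ne_top.2 (by positivity))
    _ ≤ 1 := ennreal_inv_add_one_mul_le_one S

lemma modular_div_le_one_of_luxNorm_lt (hp : ∀ x, 0 < p x) {f : X → ℝ≥0∞} {m : ℝ≥0∞}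
    (h : luxNorm μ E p f < m) : modular μ E p (fun x => f x / m) ≤ 1 := by
  obtain ⟨t, ⟨-, -, hmod⟩, htm⟩ := sInf_lt_iff.1 h
  exact (modular_mono_ae hp (.of_forall fun x => ENNReal.div_le_div_left htm.le _)).trans hmod

lemma IsExponentOn.exists_toReal_inv_le (hq : IsExponentOn μ E q) :
    ∃ κ : ℝ, 0 < κ ∧ ∀ᵐ x ∂μ.restrict E, ((q x)⁻¹).toReal ≤ κ := by
  obtain ⟨e, he0, he⟩ := exists_between hq.essInf_pos
  refine ⟨(e⁻¹).toReal, ENNReal.toReal_pos (ENNReal.inv_ne_zero.2 he.ne_top)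
    (ENNReal.inv_ne_top.2 he0.ne'), ?_⟩
  filter_upwards [ae_essInf_le (f := q) (μ := μ.restrict E)] with x hx
  exact ENNReal.toReal_mono (ENNReal.inv_ne_top.2 he0.ne')
    (ENNReal.inv_le_inv.2 (he.le.trans hx))

/-- A summand of the semi-modular of `ℓ^{q(·)}(L^{p(·)}(E))`. -/
noncomputable def besovTerm (μ : Measure X) (E : Set X) (p : X → ℝ) (q : X → ℝ≥0∞)
    (f : X → ℝ≥0∞) : ℝ≥0∞ :=
  sInf {t : ℝ≥0∞ | 0 < t ∧ t < ∞ ∧ modular μ E p (fun x => f x / t ^ ((q x)⁻¹).toReal) ≤ 1}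

lemma besovTerm_div_le (hp : ∀ x, 0 < p x) {κ : ℝ} (hκ : 0 < κ)
    (hq : ∀ᵐ x ∂μ.restrict E, ((q x)⁻¹).toReal ≤ κ) {l : ℝ≥0∞} (hl : 1 ≤ l) (hl' : l ≠ ∞)
    (f : X → ℝ≥0∞) :
    besovTerm μ E p q (fun x => f x / l) ≤ (l ^ (1 / κ))⁻¹ * besovTerm μ E p q f := by
  set c := l ^ (1 / κ) with hc
  have hc1 : 1 ≤ c := ENNReal.one_le_rpow hl (by positivity)
  have hctop : c ≠ ∞ := ENNReal.rpow_ne_top_of_nonneg (by positivity) hl'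
  rw [← ENNReal.div_eq_inv_mul,
    ENNReal.le_div_iff_mul_le (.inl (one_pos.trans_le hc1).ne') (.inl hctop)]
  refine le_sInf fun t ⟨ht0, httop, hmod⟩ => ?_
  rw [← ENNReal.le_div_iff_mul_le (.inl (one_pos.trans_le hc1).ne') (.inl hctop)]
  refine sInf_le ⟨ENNReal.div_pos ht0.ne' hctop, ENNReal.div_lt_top httop.ne
    (one_pos.trans_le hc1).ne', (modular_mono_ae hp ?_).trans hmod⟩
  filter_upwards [hq] with x hx
  have hr : 0 ≤ ((q x)⁻¹).toReal := ENNReal.toReal_nonneg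
  have hcl : c ^ ((q x)⁻¹).toReal ≤ l := by
    calc c ^ ((q x)⁻¹).toReal ≤ c ^ κ := ENNReal.rpow_le_rpow_of_exponent_le hc1 hx
      _ = l := by rw [hc, ← ENNReal.rpow_mul, one_div_mul_cancel hκ.ne', ENNReal.rpow_one]
  have hpow0 : c ^ ((q x)⁻¹).toReal ≠ 0 :=
    (ENNReal.rpow_pos (one_pos.trans_le hc1) hctop).ne'
  have hpowtop : c ^ ((q x)⁻¹).toReal ≠ ∞ := ENNReal.rpow_ne_top_of_nonneg hr hctop
  calc f x / l / (t / c) ^ ((q x)⁻¹).toReal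
      = f x / t ^ ((q x)⁻¹).toReal * (c ^ ((q x)⁻¹).toReal / l) := by
        rw [ENNReal.div_rpow_of_nonneg _ _ hr, div_eq_mul_inv, ENNReal.inv_div (.inl hpowtop)
          (.inl hpow0)]
        simp only [div_eq_mul_inv]
        ring
    _ ≤ f x / t ^ ((q x)⁻¹).toReal :=
        mul_le_of_le_one_right zero_le (ENNReal.div_le_of_le_mul (by rwa [one_mul]))

lemma besovModular_div_le (hp : ∀ x, 0 < p x) {κ : ℝ} (hκ : 0 < κ)
    (hq : ∀ᵐ x ∂μ.restrict E, ((q x)⁻¹).toReal ≤ κ) {l : ℝ≥0∞} (hl : 1 ≤ l) (hl' : l ≠ ∞)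
    (g : ℤ → X → ℝ≥0∞) :
    besovModular μ E p q (fun k x => g k x / l) ≤ (l ^ (1 / κ))⁻¹ * besovModular μ E p q g := by
  calc besovModular μ E p q (fun k x => g k x / l)
      ≤ ∑' k, (l ^ (1 / κ))⁻¹ * besovTerm μ E p q (g k) :=
        ENNReal.tsum_le_tsum fun k => besovTerm_div_le hp hκ hq hl hl' (g k)
    _ = (l ^ (1 / κ))⁻¹ * besovModular μ E p q g := ENNReal.tsum_mul_left

lemma mixedNorm_besov_lt_top (hp : ∀ x, 0 < p x) (hq : IsExponentOn μ E q) {g : ℤ → X → ℝ≥0∞}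
    (hg : MemMixed .besov μ E p q g) : mixedNorm .besov μ E p q g < ∞ := by
  obtain ⟨κ, hκ, hqκ⟩ := hq.exists_toReal_inv_le
  obtain ⟨-, t, ht0, httop, hfin⟩ := hg
  set S := besovModular μ E p q (fun k x => g k x / t)
  set l := (S + 1) ^ κ with hl
  have hl1 : 1 ≤ l := ENNReal.one_le_rpow le_add_self hκ
  have hltop : l ≠ ∞ := ENNReal.rpow_ne_top_of_nonneg hκ.le (by finiteness)
  have hlt : t * l < ∞ := ENNReal.mul_lt_top httop hltop.lt_top
  have hl0 : l ≠ 0 := (one_pos.trans_le hl1).ne'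
  refine lt_of_le_of_lt (sInf_le ⟨ENNReal.mul_pos ht0.ne' hl0, hlt, ?_⟩) hlt
  calc besovModular μ E p q (fun k x => g k x / (t * l))
      = besovModular μ E p q (fun k x => g k x / t / l) := by
        simp only [div_eq_mul_inv, mul_assoc, ENNReal.mul_inv (.inl ht0.ne') (.inr hl0)]
    _ ≤ (l ^ (1 / κ))⁻¹ * S := besovModular_div_le hp hκ hqκ hl1 hltop _
    _ = (S + 1)⁻¹ * S := by
        rw [hl, ← ENNReal.rpow_mul, mul_one_div_cancel hκ.ne', ENNReal.rpow_one]
    _ ≤ 1 := ennreal_inv_add_one_mul_le_one S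

lemma besovModular_div_lt_one_of_mixedNorm_lt (hp : ∀ x, 0 < p x) (hq : IsExponentOn μ E q)
    {g : ℤ → X → ℝ≥0∞} {m : ℝ≥0∞} (hm : m ≠ ∞) (h : mixedNorm .besov μ E p q g < m) :
    besovModular μ E p q (fun k x => g k x / m) < 1 := by
  obtain ⟨κ, hκ, hqκ⟩ := hq.exists_toReal_inv_le
  obtain ⟨t, ⟨ht0, httop, hmod⟩, htm⟩ := sInf_lt_iff.1 h
  have hl : 1 < m / t := by
    rwa [ENNReal.lt_div_iff_mul_lt (.inl ht0.ne') (.inl httop.ne), one_mul]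
  have hltop : m / t ≠ ∞ := (ENNReal.div_lt_top hm ht0.ne').ne
  calc besovModular μ E p q (fun k x => g k x / m)
      = besovModular μ E p q (fun k x => g k x / t / (m / t)) := by
        congr 1 with k x
        rw [div_eq_mul_inv (_ / t), ENNReal.inv_div (.inl httop.ne) (.inl ht0.ne'),
          ← mul_div_assoc, ENNReal.div_mul_cancel ht0.ne' httop.ne]
    _ ≤ ((m / t) ^ (1 / κ))⁻¹ * besovModular μ E p q (fun k x => g k x / t) :=
        besovModular_div_le hp hκ hqκ hl.le hltop _
    _ ≤ ((m / t) ^ (1 / κ))⁻¹ := mul_le_of_le_one_right zero_le hmod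
    _ < 1 := ENNReal.inv_lt_one.2 (ENNReal.one_lt_rpow hl (by positivity))

lemma modular_le_besovTerm (hE : MeasurableSet E) (hp : ∀ x, 0 < p x) (hq : ∀ x ∈ E, 0 < q x)
    (hqp : ∀ x ∈ E, q x ≤ ENNReal.ofReal (p x)) {f : X → ℝ≥0∞} (h : besovTerm μ E p q f < 1) :
    modular μ E p f ≤ besovTerm μ E p q f := by
  refine le_of_forall_gt fun a ha => ?_
  obtain ⟨t, ⟨ht0, httop, hmod⟩, hta⟩ := sInf_lt_iff.1 (lt_min ha h)
  have ht1 : t ≤ 1 := hta.le.trans (min_le_right _ _)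
  refine lt_of_le_of_lt ?_ (hta.trans_le (min_le_left _ _))
  have hrp : ∀ x ∈ E, 1 ≤ ((q x)⁻¹).toReal * p x := fun x hx => by
    have := ENNReal.toReal_mono (ENNReal.inv_ne_top.2 (hq x hx).ne')
      (ENNReal.inv_le_inv.2 (hqp x hx))
    rwa [ENNReal.toReal_inv, ENNReal.toReal_ofReal (hp x).le, inv_le_iff_one_le_mul₀ (hp x)] at this
  calc modular μ E p f ≤ ∫⁻ x in E, (f x / t ^ ((q x)⁻¹).toReal) ^ p x * t ∂μ := by
        refine lintegral_mono_ae ((ae_restrict_iff' hE).2 (.of_forall fun x hx => ?_))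
        have hpow : t ^ (((q x)⁻¹).toReal * p x) ≤ t :=
          ENNReal.rpow_le_self_of_le_one ht1 (hrp x hx)
        rw [ENNReal.div_rpow_of_nonneg _ _ (hp x).le, ← ENNReal.rpow_mul, div_eq_mul_inv,
          mul_assoc, mul_comm _ t, ← div_eq_mul_inv]
        refine le_mul_of_one_le_right zero_le ?_
        rwa [ENNReal.le_div_iff_mul_le (.inl (ENNReal.rpow_pos ht0 httop.ne).ne')
          (.inl (ENNReal.rpow_ne_top_of_nonneg (zero_le_one.trans (hrp x hx)) httop.ne)), one_mul]
    _ = modular μ E p (fun x => f x / t ^ ((q x)⁻¹).toReal) * t :=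
        lintegral_mul_const' _ _ httop.ne
    _ ≤ t := mul_le_of_le_one_left zero_le hmod

lemma modular_iSup_le_tsum (hpm : Measurable p) (hp : ∀ x, 0 < p x) {g : ℤ → X → ℝ≥0∞}
    (hg : ∀ k, AEMeasurable (g k) (μ.restrict E)) :
    modular μ E p (fun x => ⨆ k, g k x) ≤ ∑' k, modular μ E p (g k) := by
  calc modular μ E p (fun x => ⨆ k, g k x) ≤ ∫⁻ x in E, ∑' k, g k x ^ p x ∂μ := by
        refine lintegral_mono fun x => ?_
        dsimp only
        rw [← ENNReal.le_rpow_inv_iff (hp x)]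
        refine iSup_le fun k => ?_
        rw [ENNReal.le_rpow_inv_iff (hp x)]
        exact ENNReal.le_tsum (f := fun k => g k x ^ p x) k
    _ = ∑' k, modular μ E p (g k) := lintegral_tsum fun k => (hg k).pow hpm.aemeasurable

lemma modular_iSup_le_besovModular (hE : MeasurableSet E) (hpm : Measurable p)
    (hp : ∀ x, 0 < p x) (hq : ∀ x ∈ E, 0 < q x) (hqp : ∀ x ∈ E, q x ≤ ENNReal.ofReal (p x))
    {g : ℤ → X → ℝ≥0∞} (hg : ∀ k, AEMeasurable (g k) (μ.restrict E))
    (h : besovModular μ E p q g < 1) :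
    modular μ E p (fun x => ⨆ k, g k x) ≤ besovModular μ E p q g :=
  (modular_iSup_le_tsum hpm hp hg).trans <| ENNReal.tsum_le_tsum fun k =>
    modular_le_besovTerm hE hp hq hqp <|
      (ENNReal.le_tsum (f := fun k => besovTerm μ E p q (g k)) k).trans_lt h

lemma mixedNorm_lt_top {A : Scale} {lo : ℝ} (hlo : 0 < lo) (hp : ∀ x, lo ≤ p x)
    (hq : IsExponentOn μ E q) {g : ℤ → X → ℝ≥0∞} (hg : MemMixed A μ E p q g) :
    mixedNorm A μ E p q g < ∞ := by
  cases A with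
  | triebelLizorkin => exact luxNorm_lt_top hlo hp hg.2
  | besov => exact mixedNorm_besov_lt_top (fun x => hlo.trans_le (hp x)) hq hg

lemma modular_iSup_div_le_one {A : Scale} (hE : MeasurableSet E) (hpm : Measurable p)
    (hp : ∀ x, 0 < p x) (hq : IsExponentOn μ E q)
    (hqp : A = .besov → ∀ x ∈ E, q x ≤ ENNReal.ofReal (p x)) {g : ℤ → X → ℝ≥0∞}
    (hg : ∀ k, AEMeasurable (g k) (μ.restrict E)) {m : ℝ≥0∞} (hm : m ≠ ∞)
    (h : mixedNorm A μ E p q g < m) : modular μ E p (fun x => (⨆ k, g k x) / m) ≤ 1 := by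
  cases A with
  | triebelLizorkin =>
    refine (modular_mono_ae hp ?_).trans (modular_div_le_one_of_luxNorm_lt hp h)
    refine (ae_restrict_iff' hE).2 (.of_forall fun x hx => ?_)
    gcongr
    exact iSup_le_seqNorm (hq.pos x hx) _
  | besov =>
    have hlt := besovModular_div_lt_one_of_mixedNorm_lt hp hq hm h
    simp only [ENNReal.iSup_div]
    exact (modular_iSup_le_besovModular hE hpm hp hq.pos (hqp rfl)
      (fun k => (hg k).div_const m) hlt).trans hlt.le

lemma ae_ne_top_of_modular_div_le_one (hpm : Measurable p) (hp : ∀ x, 0 < p x) {G : X → ℝ≥0∞}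
    (hG : AEMeasurable G (μ.restrict E)) {m : ℝ≥0∞} (hm : m ≠ ∞)
    (h : modular μ E p (fun x => G x / m) ≤ 1) : ∀ᵐ x ∂μ.restrict E, G x ≠ ∞ := by
  filter_upwards [ae_lt_top' ((hG.div_const m).pow hpm.aemeasurable)
    (h.trans_lt ENNReal.one_lt_top).ne] with x hx hGx
  rw [hGx, ENNReal.top_div_of_ne_top hm, ENNReal.top_rpow_of_pos (hp x)] at hx
  exact hx.false

lemma ae_restrict_mem_of_measure_diff {U D B : Set X} (hB : MeasurableSet B) (hBU : B ⊆ U)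
    (hD : μ (U \ D) = 0) : ∀ᵐ x ∂μ.restrict B, x ∈ D ∩ B := by
  rw [ae_restrict_iff' hB]
  filter_upwards [measure_eq_zero_iff_ae_notMem.1 hD] with x hx hxB
  exact ⟨by_contra fun h => hx ⟨hBU hxB, h⟩, hxB⟩

lemma exists_le_of_one_lt_mul_measure {U D B : Set X} (hB : MeasurableSet B) (hBU : B ⊆ U)
    (hD : μ (U \ D) = 0) {h : X → ℝ} (hint : ∫⁻ x in U, ENNReal.ofReal (h x) ∂μ ≤ 1) {L : ℝ}
    (hL : 1 < ENNReal.ofReal L * μ B) : ∃ z ∈ D ∩ B, h z ≤ L := by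
  by_contra! hcon
  refine (hL.trans_le ?_).false
  calc ENNReal.ofReal L * μ B = ∫⁻ _ in B, ENNReal.ofReal L ∂μ := (setLIntegral_const _ _).symm
    _ ≤ ∫⁻ x in B, ENNReal.ofReal (h x) ∂μ :=
        lintegral_mono_ae ((ae_restrict_mem_of_measure_diff hB hBU hD).mono fun x hx =>
          ENNReal.ofReal_le_ofReal (hcon x hx).le)
    _ ≤ ∫⁻ x in U, ENNReal.ofReal (h x) ∂μ := lintegral_mono_set hBU
    _ ≤ 1 := hint

end MixedNorm

lemma exists_dyadic_scale {d : ℝ} (hd : 0 < d) :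
    ∃ k : ℤ, (2 : ℝ) ^ (-k - 1) ≤ d ∧ d < (2 : ℝ) ^ (-k) := by
  obtain ⟨n, h1, h2⟩ := exists_mem_Ico_zpow hd (one_lt_two (α := ℝ))
  exact ⟨-n - 1, by simpa using h1, by simpa [add_comm] using h2⟩

lemma isScalarGradient_div_rpow {X : Type*} [MetricSpace X] {p s : X → ℝ} (hp : ∀ x, 0 < p x)
    {D : Set X} {u G : X → ℝ} {m : ℝ} (hm : 0 < m) (hG : ∀ x, 0 ≤ G x)
    (h : ∀ x ∈ D, ∀ y ∈ D, |u x - u y| ≤ dist x y ^ s x * G x + dist x y ^ s y * G y) :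
    IsScalarGradient p s D (fun x => u x / m) (fun x => (G x / m) ^ p x) := by
  have hGm : ∀ x, 0 ≤ G x / m := fun x => div_nonneg (hG x) hm.le
  refine ⟨fun x => Real.rpow_nonneg (hGm x) _, fun x hx y hy => ?_⟩
  have hroot : ∀ z, ((G z / m) ^ p z) ^ (1 / p z) = G z / m := fun z => by
    rw [← Real.rpow_mul (hGm z), mul_one_div_cancel (hp z).ne', Real.rpow_one]
  rw [hroot, hroot, ← sub_div, abs_div, abs_of_pos hm, mul_div_assoc', mul_div_assoc', ← add_div]
  gcongr
  exact h x hx y hy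

section ScalarGradientBound

variable {X : Type*} [MetricSpace X] [MeasurableSpace X] {μ : Measure X} {Q p s : X → ℝ}
  {lo hi b δ σ : ℝ}

lemma IsVectorGradient.exists_abs_sub_le_iSup {E : Set X} {u : X → EReal} {g : ℤ → X → ℝ≥0∞}
    (h : IsVectorGradient μ E s u g) : ∃ N : Set X, μ N = 0 ∧
      ∀ x ∈ {x ∈ E \ N | ⨆ k, g k x ≠ ∞}, ∀ y ∈ {x ∈ E \ N | ⨆ k, g k x ≠ ∞},
        |(u x).toReal - (u y).toReal| ≤
          dist x y ^ s x * (⨆ k, g k x).toReal + dist x y ^ s y * (⨆ k, g k y).toReal := by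
  obtain ⟨-, N, hN, hgrad⟩ := h
  refine ⟨N, hN, fun x hx y hy => ?_⟩
  rcases eq_or_ne x y with rfl | hne
  · rw [sub_self, abs_zero]
    positivity
  obtain ⟨k, hk, hk'⟩ := exists_dyadic_scale (dist_pos.2 hne)
  have hcomp : ∀ z, ⨆ k, g k z ≠ ∞ → g k z ≤ ENNReal.ofReal (⨆ k, g k z).toReal := fun z hz => by
    rw [ENNReal.ofReal_toReal hz]
    exact le_iSup (fun k => g k z) k
  rw [← ENNReal.ofReal_le_ofReal_iff (by positivity), ENNReal.ofReal_add (by positivity)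
    (by positivity), ENNReal.ofReal_mul (by positivity), ENNReal.ofReal_mul (by positivity)]
  refine (hgrad k x hx.1 y hy.1 hk hk').trans ?_
  gcongr
  exacts [hcomp x hx.2, hcomp y hy.2]

/-- Off a null set `U \ D`, the function `u` has a scalar Hajłasz gradient whose Luxemburg norm in
`L^{p(·)}(U)` is at most `N`. The norm bound is expressed, without attaining the infimum, by
normalising with every `m > N`. -/
structure HasScalarGradientBound (μ : Measure X) (p s : X → ℝ) (U D : Set X) (u : X → ℝ)
    (N : ℝ≥0∞) : Prop where
  ne_top : N ≠ ∞
  measure_diff : μ (U \ D) = 0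
  exists_gradient : ∀ m, N.toReal < m → ∃ h, IsScalarGradient p s D (fun x => u x / m) h ∧
    ∫⁻ x in U, ENNReal.ofReal (h x) ∂μ ≤ 1

lemma LocalData.mixedNorm_lt_top {A : Scale} (hE : Exponents Q p s lo hi) {x₀ : X} {r₀ : ℝ}
    {q : X → ℝ≥0∞} {u : X → EReal} {g : ℤ → X → ℝ≥0∞} (hl : LocalData A μ s p δ σ x₀ r₀ q u g) :
    mixedNorm A μ (ball x₀ (σ * r₀)) p q g < ∞ :=
  HajlaszVar.mixedNorm_lt_top hE.lo_pos (fun x => (hE.p_mem x).1) hl.exponent hl.gradient_mem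

variable [BorelSpace X]

lemma LocalData.exists_hasScalarGradientBound {A : Scale} (hp : Measurable p)
    (hE : Exponents Q p s lo hi) {x₀ : X} {r₀ : ℝ} {q : X → ℝ≥0∞} {u : X → EReal}
    {g : ℤ → X → ℝ≥0∞} (hl : LocalData A μ s p δ σ x₀ r₀ q u g) :
    ∃ D, HasScalarGradientBound μ p s (ball x₀ (σ * r₀)) D (fun x => (u x).toReal)
      (mixedNorm A μ (ball x₀ (σ * r₀)) p q g) := by
  have hfin := hl.mixedNorm_lt_top hE
  set U := ball x₀ (σ * r₀)
  have hmod : ∀ m : ℝ≥0∞, m ≠ ∞ → mixedNorm A μ U p q g < m →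
      modular μ U p (fun x => (⨆ k, g k x) / m) ≤ 1 := fun m hm hlt =>
    modular_iSup_div_le_one measurableSet_ball hp hE.p_pos hl.exponent hl.exponent_le
      hl.gradient.1 hm hlt
  obtain ⟨N, hN, hgrad⟩ := hl.gradient.exists_abs_sub_le_iSup
  obtain ⟨m₀, hm₀, hm₀top⟩ := exists_between hfin
  have hGfin := ae_ne_top_of_modular_div_le_one hp hE.p_pos (.iSup hl.gradient.1) hm₀top.ne
    (hmod m₀ hm₀top.ne hm₀)
  refine ⟨{x ∈ U \ N | ⨆ k, g k x ≠ ∞}, hfin.ne, ?_, fun m hm => ?_⟩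
  · rw [measure_eq_zero_iff_ae_notMem]
    filter_upwards [measure_eq_zero_iff_ae_notMem.1 hN,
      (ae_restrict_iff' measurableSet_ball).1 hGfin] with x hxN hxG ⟨hxU, hx⟩
    exact hx ⟨⟨hxU, hxN⟩, hxG hxU⟩
  · have hm0 : 0 < m := ENNReal.toReal_nonneg.trans_lt hm
    refine ⟨_, isScalarGradient_div_rpow hE.p_pos hm0 (fun _ => ENNReal.toReal_nonneg) hgrad,
      (lintegral_mono fun x => ?_).trans
        (hmod _ ENNReal.ofReal_ne_top ((ENNReal.lt_ofReal_iff_toReal_lt hfin.ne).2 hm))⟩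
    rw [← ENNReal.ofReal_rpow_of_nonneg (by positivity) (hE.p_pos x).le,
      ENNReal.ofReal_div_of_pos hm0]
    exact ENNReal.rpow_le_rpow (ENNReal.div_le_div_right ENNReal.ofReal_toReal_le _)
      (hE.p_pos x).le

lemma LowerGrowth.hasModerateValues (hμ : LowerGrowth μ Q b δ) (hb : 0 < b) {U D : Set X}
    (hD : μ (U \ D) = 0) {h : X → ℝ} (hint : ∫⁻ x in U, ENNReal.ofReal (h x) ∂μ ≤ 1) :
    HasModerateValues Q (2 / b) δ U D h := by
  intro y ρ hρ hρδ hball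
  obtain ⟨z, ⟨hzD, hzB⟩, hz⟩ := exists_le_of_one_lt_mul_measure (L := 2 / b * ρ ^ (-Q y))
    (measurableSet_ball (x := y) (ε := ρ)) hball hD hint (by
      calc (1 : ℝ≥0∞) < ENNReal.ofReal 2 := by simp
        _ = ENNReal.ofReal (2 / b * ρ ^ (-Q y)) * ENNReal.ofReal (b * ρ ^ Q y) := by
            rw [← ENNReal.ofReal_mul (by positivity), mul_mul_mul_comm, ← Real.rpow_add hρ,
              neg_add_cancel, Real.rpow_zero, div_mul_cancel₀ _ hb.ne', mul_one]
        _ ≤ ENNReal.ofReal (2 / b * ρ ^ (-Q y)) * μ (ball y ρ) := by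
            gcongr
            exact hμ y ρ hρ hρδ)
  exact ⟨z, hzD, mem_ball'.1 hzB, hz⟩

end ScalarGradientBound

/-! ### Averages -/

lemma convexOn_exp_mul_abs_sub {c : ℝ} (hc : 0 ≤ c) (a : ℝ) :
    ConvexOn ℝ univ fun x : ℝ => Real.exp (c * |x - a|) := by
  have habs : ConvexOn ℝ univ fun x : ℝ => c * |x - a| :=
    ((convexOn_univ_norm (E := ℝ)).translate_left (-a)).smul hc
  exact ⟨convex_univ, fun x hx y hy t r ht hr htr =>
    (Real.exp_le_exp.2 (habs.2 hx hy ht hr htr)).trans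
      (convexOn_exp.2 (mem_univ _) (mem_univ _) ht hr htr)⟩

section Average

variable {Y : Type*} [MeasurableSpace Y] {ν : Measure Y} [IsFiniteMeasure ν] {f : Y → ℝ}

lemma integrable_of_integrable_exp (hf : AEMeasurable f ν) {a c : ℝ} (hc : 0 < c)
    (h : Integrable (fun x => Real.exp (c * |f x - a|)) ν) : Integrable f ν := by
  have hsub : Integrable (fun x => f x - a) ν := by
    refine (h.const_mul c⁻¹).mono' (hf.sub_const a).aestronglyMeasurable (.of_forall fun x => ?_)
    rw [Real.norm_eq_abs, inv_mul_eq_div, le_div_iff₀ hc]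
    linarith [Real.add_one_le_exp (c * |f x - a|)]
  exact (hsub.add (integrable_const a)).congr (.of_forall fun x => sub_add_cancel _ _)

variable [NeZero ν]

lemma exp_abs_average_sub_le {a c : ℝ} (hc : 0 ≤ c) (hf : Integrable f ν)
    (h : Integrable (fun x => Real.exp (c * |f x - a|)) ν) :
    Real.exp (c * |⨍ x, f x ∂ν - a|) ≤ ⨍ x, Real.exp (c * |f x - a|) ∂ν :=
  (convexOn_exp_mul_abs_sub hc a).map_average_le (by fun_prop) isClosed_univ (by simp) hf h

lemma laverage_exp_sub_average_le (hf : AEMeasurable f ν) {a c K : ℝ} (hc : 0 < c) (hK : 0 ≤ K)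
    (h : ⨍⁻ x, ENNReal.ofReal (Real.exp (c * |f x - a|)) ∂ν ≤ ENNReal.ofReal K) :
    Integrable f ν ∧
      ⨍⁻ x, ENNReal.ofReal (Real.exp (c * |f x - ⨍ y, f y ∂ν|)) ∂ν ≤ ENNReal.ofReal (K * K) := by
  have hexp : Integrable (fun x => Real.exp (c * |f x - a|)) ν := by
    refine ⟨by fun_prop, ?_⟩
    rw [hasFiniteIntegral_iff_ofReal (.of_forall fun x => (Real.exp_pos _).le),
      ← measure_mul_laverage]
    exact ENNReal.mul_lt_top (measure_lt_top ν univ) (h.trans_lt ENNReal.ofReal_lt_top)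
  have hint := integrable_of_integrable_exp hf hc hexp
  have hjensen : Real.exp (c * |⨍ y, f y ∂ν - a|) ≤ K := by
    refine (exp_abs_average_sub_le hc.le hint hexp).trans ((ENNReal.ofReal_le_ofReal_iff hK).1 ?_)
    rwa [ofReal_average hexp (.of_forall fun x => (Real.exp_pos _).le), ← laverage_eq]
  refine ⟨hint, ?_⟩
  calc ⨍⁻ x, ENNReal.ofReal (Real.exp (c * |f x - ⨍ y, f y ∂ν|)) ∂ν
      ≤ ⨍⁻ x, ENNReal.ofReal K * ENNReal.ofReal (Real.exp (c * |f x - a|)) ∂ν := by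
        refine laverage_mono_ae (.of_forall fun x => ?_)
        dsimp only
        rw [← ENNReal.ofReal_mul hK]
        refine ENNReal.ofReal_le_ofReal ?_
        calc Real.exp (c * |f x - ⨍ y, f y ∂ν|)
            ≤ Real.exp (c * |⨍ y, f y ∂ν - a|) * Real.exp (c * |f x - a|) := by
              rw [← Real.exp_add, ← mul_add, abs_sub_comm (⨍ y, f y ∂ν), add_comm]
              gcongr
              exact abs_sub_le _ _ _
          _ ≤ K * Real.exp (c * |f x - a|) := by gcongr
    _ = ENNReal.ofReal K * ⨍⁻ x, ENNReal.ofReal (Real.exp (c * |f x - a|)) ∂ν :=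
        lintegral_const_mul' _ _ ENNReal.ofReal_ne_top
    _ ≤ ENNReal.ofReal (K * K) := by
        rw [ENNReal.ofReal_mul hK]
        gcongr

lemma abs_sub_average_le (hf : Integrable f ν) {y K : ℝ} (h : ∀ᵐ x ∂ν, |y - f x| ≤ K) :
    |y - ⨍ x, f x ∂ν| ≤ K := by
  have hmem : ⨍ x, f x ∂ν ∈ closedBall y K :=
    (convex_closedBall y K).average_mem isClosed_closedBall
      (h.mono fun x hx => by rwa [mem_closedBall', Real.dist_eq]) hf
  rwa [mem_closedBall', Real.dist_eq] at hmem

lemma integrable_of_ae_abs_sub_le (hf : AEMeasurable f ν) {K : ℝ}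
    (h : ∀ᵐ x ∂ν, ∀ᵐ y ∂ν, |f x - f y| ≤ K) : Integrable f ν := by
  obtain ⟨x, hx⟩ := h.exists
  refine .of_bound hf.aestronglyMeasurable (|f x| + K) (hx.mono fun y hy => ?_)
  rw [Real.norm_eq_abs]
  linarith [abs_sub_abs_le_abs_sub (f y) (f x), abs_sub_comm (f x) (f y)]

lemma eLpNorm_top_sub_average_le (hf : Integrable f ν) {K : ℝ}
    (h : ∀ᵐ x ∂ν, ∀ᵐ y ∂ν, |f x - f y| ≤ K) :
    eLpNorm (fun x => f x - ⨍ y, f y ∂ν) ∞ ν ≤ ENNReal.ofReal K := by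
  rw [eLpNorm_exponent_top]
  exact eLpNormEssSup_le_of_ae_bound (h.mono fun x hx => abs_sub_average_le hf hx)

end Average

/-! ### Sobolev and Moser–Trudinger embeddings -/

lemma le_apply_of_forall_gt {β : Type*} [TopologicalSpace β] [Preorder β]
    [OrderClosedTopology β] {F : ℝ → β} (hF : Continuous F) {a : β} {N : ℝ}
    (h : ∀ m, N < m → a ≤ F m) : a ≤ F N :=
  ge_of_tendsto ((hF.tendsto N).mono_left nhdsWithin_le_nhds)
    (eventually_nhdsWithin_of_forall (s := Ioi N) h)

lemma mul_le_rpow_of_le {A b T lo m γ Γ : ℝ} (hA : 1 ≤ A) (hb : 0 < b) (hb1 : b ≤ 1) (hT : b ≤ T)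
    (hlo : 0 < lo) (hm : lo ≤ m) (hmγ : m ≤ γ) (hγ : γ ≤ Γ) :
    A * T ≤ ((A / b ^ (Γ / lo)) ^ (1 / lo) * T ^ (1 / m)) ^ γ := by
  have hT0 : 0 < T := hb.trans_le hT
  have hm0 : 0 < m := hlo.trans_le hm
  have hγ0 : 0 < γ := hm0.trans_le hmγ
  have hR : γ / m ≤ Γ / lo := div_le_div₀ (hγ0.le.trans hγ) hγ hlo hm
  have hR1 : 1 ≤ γ / m := (one_le_div hm0).2 hmγ
  have hbR : b ^ (Γ / lo) ≤ 1 := Real.rpow_le_one hb.le hb1 (by linarith)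
  have hV : 1 ≤ A / b ^ (Γ / lo) := (one_le_div (by positivity)).2 (hbR.trans hA)
  have hVγ : A / b ^ (Γ / lo) ≤ ((A / b ^ (Γ / lo)) ^ (1 / lo)) ^ γ := by
    rw [← Real.rpow_mul (by positivity), one_div_mul_eq_div]
    exact Real.self_le_rpow_of_one_le hV ((one_le_div hlo).2 (hm.trans hmγ))
  have hTγ : b ^ (Γ / lo) * T ≤ (T ^ (1 / m)) ^ γ := by
    rw [← Real.rpow_mul hT0.le, one_div_mul_eq_div]
    rcases le_total 1 T with h | h
    · calc b ^ (Γ / lo) * T ≤ T := mul_le_of_le_one_left hT0.le hbR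
        _ ≤ T ^ (γ / m) := Real.self_le_rpow_of_one_le h hR1
    · calc b ^ (Γ / lo) * T ≤ b ^ (Γ / lo) := mul_le_of_le_one_right (by positivity) h
        _ ≤ T ^ (Γ / lo) := Real.rpow_le_rpow hb.le hT (by linarith)
        _ ≤ T ^ (γ / m) := Real.rpow_le_rpow_of_exponent_ge hT0 h hR
  rw [Real.mul_rpow (by positivity) (by positivity)]
  calc A * T = A / b ^ (Γ / lo) * (b ^ (Γ / lo) * T) := by field_simp
    _ ≤ _ := by gcongr

lemma luxNorm_le_of_lintegral_le {X : Type*} [MeasurableSpace X] {μ : Measure X} {E : Set X}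
    {γ f H : X → ℝ} (hγ : ∀ x, 0 < γ x) {t Z : ℝ} (ht : 0 < t) (hZ : 0 < Z)
    (h : ∀ᵐ x ∂μ.restrict E, Z * (|f x| / t) ^ γ x ≤ H x)
    (hint : ∫⁻ x in E, ENNReal.ofReal (H x) ∂μ ≤ ENNReal.ofReal Z) :
    luxNorm μ E γ (fun x => ENNReal.ofReal |f x|) ≤ ENNReal.ofReal t := by
  have hZ0 : ENNReal.ofReal Z ≠ 0 := (ENNReal.ofReal_pos.2 hZ).ne'
  refine sInf_le ⟨ENNReal.ofReal_pos.2 ht, ENNReal.ofReal_lt_top, ?_⟩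
  calc modular μ E γ (fun x => ENNReal.ofReal |f x| / ENNReal.ofReal t)
      ≤ ∫⁻ x in E, (ENNReal.ofReal Z)⁻¹ * ENNReal.ofReal (H x) ∂μ := by
        refine lintegral_mono_ae (h.mono fun x hx => ?_)
        dsimp only
        rw [← ENNReal.ofReal_div_of_pos ht, ENNReal.ofReal_rpow_of_nonneg (by positivity)
          (hγ x).le, ← ENNReal.mul_le_iff_le_inv hZ0 ENNReal.ofReal_ne_top,
          ← ENNReal.ofReal_mul hZ.le]
        exact ENNReal.ofReal_le_ofReal hx
    _ = (ENNReal.ofReal Z)⁻¹ * ∫⁻ x in E, ENNReal.ofReal (H x) ∂μ :=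
        lintegral_const_mul' _ _ (ENNReal.inv_ne_top.2 hZ0)
    _ ≤ (ENNReal.ofReal Z)⁻¹ * ENNReal.ofReal Z := by gcongr
    _ = 1 := ENNReal.inv_mul_cancel hZ0 ENNReal.ofReal_ne_top

section Embedding

variable {X : Type*} [MetricSpace X] [MeasurableSpace X] {μ : Measure X} {Q p s : X → ℝ}
  {lo b δ σ : ℝ} {x₀ : X} {r₀ : ℝ}

lemma IsMetricMeasure.isFiniteMeasure_restrict_ball (hμ : IsMetricMeasure μ) (x : X) {r : ℝ}
    (hr : 0 < r) : IsFiniteMeasure (μ.restrict (ball x r)) :=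
  isFiniteMeasure_restrict.2 (hμ x r hr).2.ne

lemma IsMetricMeasure.neZero_restrict_ball (hμ : IsMetricMeasure μ) (x : X) {r : ℝ}
    (hr : 0 < r) : NeZero (μ.restrict (ball x r)) :=
  ⟨fun h => (hμ x r hr).1.ne' (Measure.restrict_eq_zero.1 h)⟩

lemma LowerGrowth.le_measure_div (hg : LowerGrowth μ Q b δ) (hμ : IsMetricMeasure μ)
    (hr : 0 < r₀) (hrδ : r₀ ≤ δ) : b ≤ (μ (ball x₀ r₀)).toReal / r₀ ^ Q x₀ := by
  rw [le_div_iff₀ (by positivity), ← ENNReal.ofReal_le_iff_le_toReal (hμ x₀ r₀ hr).2.ne]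
  exact hg x₀ r₀ hr hrδ

lemma LowerGrowth.lintegral_rpow_neg_add_le (hg : LowerGrowth μ Q b δ) (hμ : IsMetricMeasure μ)
    (hb : 0 < b) (hr : 0 < r₀) (hrδ : r₀ ≤ δ) {h : X → ℝ}
    (hint : ∫⁻ x in ball x₀ r₀, ENNReal.ofReal (h x) ∂μ ≤ 1) :
    ∫⁻ x in ball x₀ r₀, ENNReal.ofReal (r₀ ^ (-Q x₀) + h x) ∂μ ≤
      ENNReal.ofReal ((1 + 1 / b) * ((μ (ball x₀ r₀)).toReal / r₀ ^ Q x₀)) := by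
  have hT : b ≤ (μ (ball x₀ r₀)).toReal / r₀ ^ Q x₀ := hg.le_measure_div hμ hr hrδ
  set T := (μ (ball x₀ r₀)).toReal / r₀ ^ Q x₀
  have hconst : ENNReal.ofReal (r₀ ^ (-Q x₀)) * μ (ball x₀ r₀) = ENNReal.ofReal T := by
    rw [← ENNReal.ofReal_toReal (hμ x₀ r₀ hr).2.ne, ← ENNReal.ofReal_mul (by positivity),
      Real.rpow_neg hr.le, ← div_eq_inv_mul]
  have hone : 1 ≤ 1 / b * T := by rwa [one_div_mul_eq_div, one_le_div hb]
  calc ∫⁻ x in ball x₀ r₀, ENNReal.ofReal (r₀ ^ (-Q x₀) + h x) ∂μ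
      ≤ ∫⁻ x in ball x₀ r₀, (ENNReal.ofReal (r₀ ^ (-Q x₀)) + ENNReal.ofReal (h x)) ∂μ :=
        lintegral_mono fun x => ENNReal.ofReal_add_le
    _ = ENNReal.ofReal T + ∫⁻ x in ball x₀ r₀, ENNReal.ofReal (h x) ∂μ := by
        rw [lintegral_add_left measurable_const, setLIntegral_const, hconst]
    _ ≤ ENNReal.ofReal T + ENNReal.ofReal (1 / b * T) := by
        gcongr
        exact hint.trans (ENNReal.one_le_ofReal.2 hone)
    _ = ENNReal.ofReal ((1 + 1 / b) * T) := by
        rw [← ENNReal.ofReal_add (hb.le.trans hT) (zero_le_one.trans hone), add_mul, one_mul]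

variable [BorelSpace X] {U D : Set X} {u h : X → ℝ}

lemma luxNorm_sub_le_of_rpow_le (hμ : IsMetricMeasure μ) (hg : LowerGrowth μ Q b δ) (hb : 0 < b)
    (hb1 : b ≤ 1) (hr : 0 < r₀) (hrδ : r₀ ≤ δ) (hU : ball x₀ r₀ ⊆ U) (hD : μ (U \ D) = 0)
    (hint : ∫⁻ x in U, ENNReal.ofReal (h x) ∂μ ≤ 1) {γ : X → ℝ} {Γ : ℝ} (hlo : 0 < lo)
    (hγ : ∀ x, γ x ∈ Icc lo Γ) {C m a : ℝ} (hC : 1 ≤ C) (hm : 0 < m)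
    (hpt : ∀ x ∈ D, x ∈ ball x₀ r₀ → |u x / m - a| ^ γ x ≤ C * (r₀ ^ (-Q x₀) + h x)) :
    luxNorm μ (ball x₀ r₀) γ (fun x => ENNReal.ofReal |u x - m * a|) ≤
      ENNReal.ofReal ((C * (1 + 1 / b) / b ^ (Γ / lo)) ^ (1 / lo) *
        ((μ (ball x₀ r₀)).toReal / r₀ ^ Q x₀) ^ (1 / essInf γ (μ.restrict (ball x₀ r₀))) * m) := by
  have := hμ.neZero_restrict_ball x₀ hr
  have hγ0 : ∀ x, 0 < γ x := fun x => hlo.trans_le (hγ x).1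
  have hbdd : Filter.IsBoundedUnder (· ≤ ·) (ae (μ.restrict (ball x₀ r₀))) γ :=
    Filter.isBoundedUnder_of ⟨Γ, fun x => (hγ x).2⟩
  have hinf : lo ≤ essInf γ (μ.restrict (ball x₀ r₀)) :=
    le_essInf_of_ae_le lo (.of_forall fun x => (hγ x).1) hbdd.isCoboundedUnder_ge
  have hT : b ≤ (μ (ball x₀ r₀)).toReal / r₀ ^ Q x₀ := hg.le_measure_div hμ hr hrδ
  have hint' := hg.lintegral_rpow_neg_add_le hμ hb hr hrδ ((lintegral_mono_set hU).trans hint)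
  have hb' : 0 < 1 / b := by positivity
  set T := (μ (ball x₀ r₀)).toReal / r₀ ^ Q x₀
  set g₀ := essInf γ (μ.restrict (ball x₀ r₀))
  set S := (C * (1 + 1 / b) / b ^ (Γ / lo)) ^ (1 / lo) * T ^ (1 / g₀)
  have hT0 : 0 < T := hb.trans_le hT
  have hS : 0 < S := by positivity
  refine luxNorm_le_of_lintegral_le hγ0 (mul_pos hS hm) (by positivity) ?_ hint'
  filter_upwards [ae_restrict_mem_of_measure_diff measurableSet_ball hU hD,
    ae_essInf_le (Filter.isBoundedUnder_of ⟨lo, fun x => (hγ x).1⟩)] with x ⟨hxD, hxB⟩ hxγ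
  have hSγ : C * (1 + 1 / b) * T ≤ S ^ γ x :=
    mul_le_rpow_of_le (by nlinarith) hb hb1 hT hlo hinf hxγ (hγ x).2
  have hscale : |u x - m * a| / (S * m) = |u x / m - a| / S := by
    rw [mul_comm S, ← div_div, ← abs_of_pos hm, ← abs_div, abs_of_pos hm, sub_div,
      mul_div_cancel_left₀ _ hm.ne']
  rw [hscale, Real.div_rpow (abs_nonneg _) hS.le, mul_div_assoc', div_le_iff₀ (by positivity)]
  have hnn : 0 ≤ r₀ ^ (-Q x₀) + h x :=
    nonneg_of_mul_nonneg_right ((Real.rpow_nonneg (abs_nonneg _) _).trans (hpt x hxD hxB))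
      (by positivity)
  calc (1 + 1 / b) * T * |u x / m - a| ^ γ x
      ≤ (1 + 1 / b) * T * (C * (r₀ ^ (-Q x₀) + h x)) := by gcongr; exact hpt x hxD hxB
    _ = (r₀ ^ (-Q x₀) + h x) * (C * (1 + 1 / b) * T) := by ring
    _ ≤ (r₀ ^ (-Q x₀) + h x) * S ^ γ x := by gcongr

theorem sobolev_embedding (Q p s : X → ℝ) (hb : 0 < b) (hb1 : b ≤ 1) (δ : ℝ) (hσ : 1 < σ) :
    ∃ C : ℝ, 0 < C ∧ ∀ μ : Measure X, Standing μ Q p s b δ → EssLT μ (fun x => s x * p x) Q →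
      ∀ (x₀ : X) (r₀ : ℝ) (D : Set X) (u : X → ℝ) (N : ℝ≥0∞), 0 < r₀ → r₀ ≤ δ →
      HasScalarGradientBound μ p s (ball x₀ (σ * r₀)) D u N →
      (⨅ a : ℝ, luxNorm μ (ball x₀ r₀) (sobolevExponent Q p s)
        fun x => ENNReal.ofReal |u x - a|) ≤
      ENNReal.ofReal (C * ((μ (ball x₀ r₀)).toReal / r₀ ^ Q x₀) ^
        (1 / essInf (sobolevExponent Q p s) (μ.restrict (ball x₀ r₀)))) * N := by
  by_cases hex : ∃ ν : Measure X, Standing ν Q p s b δ ∧ EssLT ν (fun x => s x * p x) Q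
  swap
  · exact ⟨1, one_pos, fun μ hμ hlt => absurd ⟨μ, hμ, hlt⟩ hex⟩
  obtain ⟨ν, hν, hlt⟩ := hex
  obtain ⟨lo, hi, hE⟩ := hν.exponents
  obtain ⟨c, hc, hα⟩ := hν.exists_diffDim_le_neg hlt
  have hM : 1 ≤ 2 / b := (one_le_div hb).2 (by linarith)
  obtain ⟨C, hC, hpt⟩ := hE.sobolev_pointwise hM δ hσ hc hα
  refine ⟨(C * (1 + 1 / b) / b ^ (hi / c / lo)) ^ (1 / lo), by positivity,
    fun μ hμ _ x₀ r₀ D u N hr hrδ ⟨hN, hD, hgrad⟩ => ?_⟩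
  have hBU : ball x₀ r₀ ⊆ ball x₀ (σ * r₀) := ball_subset_ball (by nlinarith)
  rw [← ENNReal.ofReal_toReal hN, ← ENNReal.ofReal_mul (by positivity)]
  refine le_apply_of_forall_gt (F := fun m => ENNReal.ofReal (_ * m))
    (ENNReal.continuous_ofReal.comp (continuous_const_mul _)) fun m hm => ?_
  obtain ⟨h, hu, hint⟩ := hgrad m hm
  obtain ⟨a, ha⟩ := hpt D _ h x₀ r₀ hr hrδ hu (hμ.growth.hasModerateValues hb hD hint)
  exact iInf_le_of_le (m * a) <| luxNorm_sub_le_of_rpow_le hμ.metricMeasure hμ.growth hb hb1 hr hrδ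
    hBU hD hint hE.lo_pos (hE.sobolevExponent_mem hc hα) hC (ENNReal.toReal_nonneg.trans_lt hm) ha

lemma LowerGrowth.laverage_le (hg : LowerGrowth μ Q b δ) (hμ : IsMetricMeasure μ) (hb : 0 < b)
    (hr : 0 < r₀) (hrδ : r₀ ≤ δ) (hU : ball x₀ r₀ ⊆ U) (hD : μ (U \ D) = 0)
    (hint : ∫⁻ x in U, ENNReal.ofReal (h x) ∂μ ≤ 1) {F : X → ℝ} {C : ℝ} (hC : 0 ≤ C)
    (hF : ∀ x ∈ D, x ∈ ball x₀ r₀ → F x ≤ C * (1 + h x * r₀ ^ Q x₀)) :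
    ⨍⁻ x in ball x₀ r₀, ENNReal.ofReal (F x) ∂μ ≤ ENNReal.ofReal (C * (1 + 1 / b)) := by
  rw [setLAverage_eq]
  refine ENNReal.div_le_of_le_mul ?_
  calc ∫⁻ x in ball x₀ r₀, ENNReal.ofReal (F x) ∂μ
      ≤ ∫⁻ x in ball x₀ r₀, ENNReal.ofReal (C * r₀ ^ Q x₀) *
          ENNReal.ofReal (r₀ ^ (-Q x₀) + h x) ∂μ := by
        refine lintegral_mono_ae ?_
        filter_upwards [ae_restrict_mem_of_measure_diff measurableSet_ball hU hD] with x ⟨hxD, hxB⟩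
        rw [← ENNReal.ofReal_mul (by positivity)]
        refine ENNReal.ofReal_le_ofReal ((hF x hxD hxB).trans_eq ?_)
        rw [mul_assoc, mul_add (_ ^ _), ← Real.rpow_add hr, add_neg_cancel, Real.rpow_zero,
          mul_comm (h x)]
    _ = ENNReal.ofReal (C * r₀ ^ Q x₀) *
          ∫⁻ x in ball x₀ r₀, ENNReal.ofReal (r₀ ^ (-Q x₀) + h x) ∂μ :=
        lintegral_const_mul' _ _ ENNReal.ofReal_ne_top
    _ ≤ ENNReal.ofReal (C * r₀ ^ Q x₀) *
          ENNReal.ofReal ((1 + 1 / b) * ((μ (ball x₀ r₀)).toReal / r₀ ^ Q x₀)) := by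
        gcongr
        exact hg.lintegral_rpow_neg_add_le hμ hb hr hrδ ((lintegral_mono_set hU).trans hint)
    _ = ENNReal.ofReal (C * (1 + 1 / b)) * μ (ball x₀ r₀) := by
        nth_rw 2 [← ENNReal.ofReal_toReal (hμ x₀ r₀ hr).2.ne]
        rw [← ENNReal.ofReal_mul (by positivity), ← ENNReal.ofReal_mul (by positivity)]
        congr 1
        field_simp

theorem moserTrudinger_embedding (Q p s : X → ℝ) (hb : 0 < b) (hb1 : b ≤ 1) (δ : ℝ) (hσ : 1 < σ) :
    ∃ C₁ C₂ : ℝ, 0 < C₁ ∧ 0 < C₂ ∧ ∀ μ : Measure X, Standing μ Q p s b δ →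
      (∀ x, s x * p x = Q x) →
      ∀ (x₀ : X) (r₀ : ℝ) (D : Set X) (u : X → ℝ) (N : ℝ≥0∞), 0 < r₀ → r₀ ≤ δ →
      AEMeasurable u (μ.restrict (ball x₀ r₀)) →
      HasScalarGradientBound μ p s (ball x₀ (σ * r₀)) D u N → 0 < N →
      IntegrableOn u (ball x₀ r₀) μ ∧
      ⨍⁻ x in ball x₀ r₀, ENNReal.ofReal (Real.exp
        (C₁ * (|u x - ⨍ y in ball x₀ r₀, u y ∂μ| / N.toReal))) ∂μ ≤ ENNReal.ofReal C₂ := by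
  by_cases hex : ∃ ν : Measure X, Standing ν Q p s b δ ∧ ∀ x, s x * p x = Q x
  swap
  · exact ⟨1, 1, one_pos, one_pos, fun μ hμ hQ => absurd ⟨μ, hμ, hQ⟩ hex⟩
  obtain ⟨ν, hν, hQ⟩ := hex
  obtain ⟨lo, hi, hE⟩ := hν.exponents
  have hM : 1 ≤ 2 / b := (one_le_div hb).2 (by linarith)
  have hα : ∀ x, diffDim Q p s x = 0 := fun x => by rw [hE.diffDim_eq_div, hQ, sub_self, zero_div]
  obtain ⟨c, C, hc, hC, hpt⟩ := hE.moserTrudinger_pointwise hM δ hσ hα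
  refine ⟨c / 2, C * (1 + 1 / b) * (C * (1 + 1 / b)), by positivity, by positivity,
    fun μ hμ _ x₀ r₀ D u N hr hrδ hu ⟨hN, hD, hgrad⟩ hN0 => ?_⟩
  have := hμ.metricMeasure.isFiniteMeasure_restrict_ball x₀ hr
  have := hμ.metricMeasure.neZero_restrict_ball x₀ hr
  have hBU : ball x₀ r₀ ⊆ ball x₀ (σ * r₀) := ball_subset_ball (by nlinarith)
  have hm : 0 < N.toReal := ENNReal.toReal_pos hN0.ne' hN
  obtain ⟨h, hgr, hint⟩ := hgrad (2 * N.toReal) (by linarith)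
  obtain ⟨a, ha⟩ := hpt D _ h x₀ r₀ hr hrδ hgr (hμ.growth.hasModerateValues hb hD hint)
  obtain ⟨hint', hexp⟩ := laverage_exp_sub_average_le (hu.div_const (2 * N.toReal)) hc
    (by positivity) (hμ.growth.laverage_le hμ.metricMeasure hb hr hrδ hBU hD hint hC.le ha)
  have hm2 : 0 < 2 * N.toReal := by positivity
  refine ⟨by simpa only [IntegrableOn, div_mul_cancel₀ _ hm2.ne'] using
    hint'.mul_const (2 * N.toReal), ?_⟩
  have hav : ⨍ y in ball x₀ r₀, u y / (2 * N.toReal) ∂μ =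
      (⨍ y in ball x₀ r₀, u y ∂μ) / (2 * N.toReal) := integral_div _ _
  have hscale : ∀ x y : ℝ, c / 2 * (|x - y| / N.toReal) =
      c * |x / (2 * N.toReal) - y / (2 * N.toReal)| := fun x y => by
    rw [← sub_div, abs_div, abs_of_pos hm2]
    field_simp
  simpa only [hscale, hav] using hexp

end Embedding

/-! ### Morrey embedding -/

section Extension

open Filter Topology

variable {X Y : Type*} [TopologicalSpace X] [MetricSpace Y] {f : X → Y} {F : Set X} {φ : X × X → ℝ}

lemma eventually_dist_le_of_mem (hf : ∀ x ∈ F, ∀ y ∈ F, dist (f x) (f y) ≤ φ (x, y)) (x y : X) :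
    ∀ᶠ z in 𝓝[F] x ×ˢ 𝓝[F] y, dist (f z.1) (f z.2) ≤ φ z := by
  filter_upwards [prod_mem_prod self_mem_nhdsWithin self_mem_nhdsWithin] with z hz
  exact hf z.1 hz.1 z.2 hz.2

lemma tendsto_nhdsWithin_prod_nhdsWithin (hφ : Continuous φ) (x y : X) :
    Tendsto φ (𝓝[F] x ×ˢ 𝓝[F] y) (𝓝 (φ (x, y))) :=
  (hφ.tendsto (x, y)).mono_left <|
    (Filter.prod_mono nhdsWithin_le_nhds nhdsWithin_le_nhds).trans_eq nhds_prod_eq.symm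

lemma exists_tendsto_of_dist_le [CompleteSpace Y] (hφ : Continuous φ) (hφ0 : ∀ x, φ (x, x) = 0)
    (hf : ∀ x ∈ F, ∀ y ∈ F, dist (f x) (f y) ≤ φ (x, y)) {x : X} (hx : x ∈ closure F) :
    ∃ y, Tendsto f (𝓝[F] x) (𝓝 y) := by
  have := mem_closure_iff_nhdsWithin_neBot.1 hx
  refine cauchy_map_iff_exists_tendsto.1 (cauchy_map_iff.2
    ⟨this, tendsto_uniformity_iff_dist_tendsto_zero.2 ?_⟩)
  exact squeeze_zero' (.of_forall fun _ => dist_nonneg) (eventually_dist_le_of_mem hf x x)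
    (hφ0 x ▸ tendsto_nhdsWithin_prod_nhdsWithin hφ x x)

lemma continuousOn_of_dist_le (hφ : Continuous φ) (hφ0 : ∀ x, φ (x, x) = 0)
    (hf : ∀ x ∈ F, ∀ y ∈ F, dist (f x) (f y) ≤ φ (x, y)) : ContinuousOn f F := fun x hx => by
  have hlim : Tendsto (fun y => φ (y, x)) (𝓝[F] x) (𝓝 0) :=
    hφ0 x ▸ ((hφ.comp (by fun_prop : Continuous fun y => (y, x))).tendsto x).mono_left
      nhdsWithin_le_nhds
  exact tendsto_iff_dist_tendsto_zero.2 <| squeeze_zero' (.of_forall fun _ => dist_nonneg)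
    (eventually_nhdsWithin_of_forall fun y hy => hf y hy x hx) hlim

lemma exists_continuousOn_extension_of_dist_le [CompleteSpace Y] {B : Set X}
    (hFB : B ⊆ closure F) (hφ : Continuous φ) (hφ0 : ∀ x, φ (x, x) = 0)
    (hf : ∀ x ∈ F, ∀ y ∈ F, dist (f x) (f y) ≤ φ (x, y)) :
    ∃ v : X → Y, ContinuousOn v B ∧ EqOn v f F ∧
      ∀ x ∈ B, ∀ y ∈ B, dist (v x) (v y) ≤ φ (x, y) := by
  have hex : ∀ x ∈ B, ∃ y, Tendsto f (𝓝[F] x) (𝓝 y) := fun x hx =>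
    exists_tendsto_of_dist_le hφ hφ0 hf (hFB hx)
  refine ⟨extendFrom F f, continuousOn_extendFrom hFB hex, fun x hx =>
    extendFrom_eq (subset_closure hx) (continuousOn_of_dist_le hφ hφ0 hf x hx),
    fun x hx y hy => ?_⟩
  have := mem_closure_iff_nhdsWithin_neBot.1 (hFB hx)
  have := mem_closure_iff_nhdsWithin_neBot.1 (hFB hy)
  exact le_of_tendsto_of_tendsto
    (((tendsto_extendFrom (hex x hx)).comp tendsto_fst).dist
      ((tendsto_extendFrom (hex y hy)).comp tendsto_snd))
    (tendsto_nhdsWithin_prod_nhdsWithin hφ x y) (eventually_dist_le_of_mem hf x y)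

end Extension

lemma le_mul_rpow_radius_ratio {a C δ σ r : ℝ} (ha : 0 ≤ a) (hC : 0 ≤ C) (hσ : 1 < σ) (hr : 0 < r)
    (hrδ : r ≤ δ) : C ≤ 2 ^ (a + 1) * C * (σ * δ / ((σ - 1) * r)) ^ a := by
  have htwo : (1 : ℝ) ≤ 2 ^ (a + 1) := Real.one_le_rpow one_le_two (by linarith)
  have hratio : 1 ≤ (σ * δ / ((σ - 1) * r)) ^ a := by
    refine Real.one_le_rpow ?_ ha
    rw [one_le_div (mul_pos (by linarith) hr)]
    nlinarith
  calc C ≤ 2 ^ (a + 1) * C := le_mul_of_one_le_left hC htwo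
    _ ≤ _ := le_mul_of_one_le_right (by positivity) hratio

section Morrey

variable {X : Type*} [MetricSpace X] {Q p s : X → ℝ} {lo hi b δ σ : ℝ}

lemma Exponents.exists_dist_rpow_diffDim_le (hE : Exponents Q p s lo hi)
    (hα : ∀ x, 0 < diffDim Q p s x) (δ : ℝ) :
    ∃ C, 1 ≤ C ∧ ∀ (x₀ : X) (r₀ : ℝ), 0 < r₀ → r₀ ≤ δ → ∀ x ∈ ball x₀ r₀, ∀ y ∈ ball x₀ r₀,
      dist x y ^ diffDim Q p s x ≤ C * r₀ ^ diffDim Q p s x₀ := by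
  obtain ⟨C, hC, hLH⟩ := hE.logHolder_diffDim.rpow_le (R := δ) one_pos
  refine ⟨2 ^ max hi 0 * C, one_le_mul_of_one_le_of_one_le
    (Real.one_le_rpow one_le_two (le_max_right _ _)) hC, fun x₀ r₀ hr hrδ x hx y hy => ?_⟩
  have hxy : dist x y ≤ 2 * r₀ := by
    linarith [dist_triangle_right x y x₀, mem_ball.1 hx, mem_ball.1 hy]
  have hfreeze : r₀ ^ diffDim Q p s x ≤ C * r₀ ^ diffDim Q p s x₀ :=
    hLH x x₀ r₀ hr hrδ (by rw [one_mul]; exact (mem_ball.1 hx).le)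
  calc dist x y ^ diffDim Q p s x ≤ (2 * r₀) ^ diffDim Q p s x :=
        Real.rpow_le_rpow dist_nonneg hxy (hα x).le
    _ = 2 ^ diffDim Q p s x * r₀ ^ diffDim Q p s x := Real.mul_rpow zero_le_two hr.le
    _ ≤ 2 ^ max hi 0 * (C * r₀ ^ diffDim Q p s x₀) := by
        gcongr
        exacts [one_le_two, (hE.diffDim_le x).trans (le_max_left _ _)]
    _ = _ := (mul_assoc _ _ _).symm

variable [MeasurableSpace X] {μ : Measure X} {U D : Set X} {x₀ : X} {r₀ : ℝ} {u : X → ℝ}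

lemma IsMetricMeasure.ball_subset_closure_inter (hμ : IsMetricMeasure μ)
    (hU : ball x₀ r₀ ⊆ U) (hD : μ (U \ D) = 0) : ball x₀ r₀ ⊆ closure (D ∩ ball x₀ r₀) := by
  intro x hx
  refine mem_closure_iff.2 fun o ho hxo => ?_
  obtain ⟨t, ht, htB⟩ := Metric.isOpen_iff.1 (ho.inter isOpen_ball) x ⟨hxo, hx⟩
  by_contra hempty
  have hsub : ball x t ⊆ U \ D := fun y hy =>
    ⟨hU (htB hy).2, fun hyD => hempty ⟨y, (htB hy).1, hyD, (htB hy).2⟩⟩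
  exact (hμ x t ht).1.ne' (measure_mono_null hsub hD)

lemma Exponents.le_essSup_diffDim (hE : Exponents Q p s lo hi) [NeZero μ] {c : ℝ}
    (hc : ∀ x, c ≤ diffDim Q p s x) : c ≤ essSup (diffDim Q p s) μ := by
  obtain ⟨x, hx⟩ := (ae_le_essSup (μ := μ) (f := diffDim Q p s)
    (Filter.isBoundedUnder_of ⟨hi, hE.diffDim_le⟩)).exists
  exact (hc x).trans hx

variable [BorelSpace X]

lemma ae_ae_of_forall_mem_inter (hU : ball x₀ r₀ ⊆ U) (hD : μ (U \ D) = 0) {P : X → X → Prop}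
    (h : ∀ x ∈ D ∩ ball x₀ r₀, ∀ y ∈ D ∩ ball x₀ r₀, P x y) :
    ∀ᵐ x ∂μ.restrict (ball x₀ r₀), ∀ᵐ y ∂μ.restrict (ball x₀ r₀), P x y := by
  have haeD := ae_restrict_mem_of_measure_diff measurableSet_ball hU hD
  filter_upwards [haeD] with x hx
  filter_upwards [haeD] with y hy
  exact h x hx y hy

lemma exists_holder_representative (hμ : IsMetricMeasure μ) (hU : ball x₀ r₀ ⊆ U)
    (hD : μ (U \ D) = 0) {α : X → ℝ} (hα : Continuous α) (hα0 : ∀ x, 0 < α x) {K : ℝ}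
    (hu : ∀ x ∈ D ∩ ball x₀ r₀, ∀ y ∈ D ∩ ball x₀ r₀, |u x - u y| ≤ K * dist x y ^ α x) :
    ∃ v : X → ℝ, ContinuousOn v (ball x₀ r₀) ∧ u =ᵐ[μ.restrict (ball x₀ r₀)] v ∧
      ∀ x ∈ ball x₀ r₀, ∀ y ∈ ball x₀ r₀, |v x - v y| ≤ K * dist x y ^ α x := by
  have hφ : Continuous fun z : X × X => K * dist z.1 z.2 ^ α z.1 :=
    continuous_const.mul ((continuous_fst.dist continuous_snd).rpow (hα.comp continuous_fst)
      fun z => Or.inr (hα0 z.1))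
  obtain ⟨v, hvc, hvu, hv⟩ := exists_continuousOn_extension_of_dist_le (f := u)
    (hμ.ball_subset_closure_inter hU hD) hφ
    (fun x => by rw [dist_self, Real.zero_rpow (hα0 x).ne', mul_zero]) hu
  exact ⟨v, hvc, (ae_restrict_mem_of_measure_diff measurableSet_ball hU hD).mono
    fun x hx => (hvu hx).symm, hv⟩

lemma Exponents.exists_abs_sub_le (hE : Exponents Q p s lo hi) (hb : 0 < b) (hb1 : b ≤ 1) (δ : ℝ)
    (hσ : 1 < σ) {c : ℝ} (hc : 0 < c) (hα : ∀ x, c ≤ diffDim Q p s x) :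
    ∃ C : ℝ, 0 < C ∧ ∀ μ : Measure X, LowerGrowth μ Q b δ →
      ∀ (x₀ : X) (r₀ : ℝ) (D : Set X) (u : X → ℝ) (N : ℝ≥0∞), r₀ ≤ δ →
      HasScalarGradientBound μ p s (ball x₀ (σ * r₀)) D u N →
      ∀ x ∈ D ∩ ball x₀ r₀, ∀ y ∈ D ∩ ball x₀ r₀,
        |u x - u y| ≤ C * N.toReal * dist x y ^ diffDim Q p s x := by
  have hM : 1 ≤ 2 / b := (one_le_div hb).2 (by linarith)
  obtain ⟨C, hC, hpt⟩ := hE.morrey_pointwise hM δ hσ hc hα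
  refine ⟨C, hC, fun μ hg x₀ r₀ D u N hrδ ⟨_, hD, hgrad⟩ x hx y hy => ?_⟩
  refine le_apply_of_forall_gt (F := fun m => C * m * dist x y ^ diffDim Q p s x)
    (by fun_prop) fun m hm => ?_
  have hm0 : 0 < m := ENNReal.toReal_nonneg.trans_lt hm
  obtain ⟨h, hgr, hint⟩ := hgrad m hm
  have hscaled := hpt D _ h x₀ r₀ hrδ hgr (hg.hasModerateValues hb hD hint) x hx.1 hx.2 y hy.1 hy.2
  rwa [← sub_div, abs_div, abs_of_pos hm0, div_le_iff₀ hm0, mul_right_comm] at hscaled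

theorem morrey_embedding (Q p s : X → ℝ) (hb : 0 < b) (hb1 : b ≤ 1) (δ : ℝ) (hσ : 1 < σ) :
    ∃ C : ℝ, 0 < C ∧ ∀ μ : Measure X, Standing μ Q p s b δ → EssLT μ Q (fun x => s x * p x) →
      ∀ (x₀ : X) (r₀ : ℝ) (D : Set X) (u : X → ℝ) (N : ℝ≥0∞), 0 < r₀ → r₀ ≤ δ →
      AEMeasurable u (μ.restrict (ball x₀ r₀)) →
      HasScalarGradientBound μ p s (ball x₀ (σ * r₀)) D u N →
      IntegrableOn u (ball x₀ r₀) μ ∧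
      eLpNorm (fun x => u x - ⨍ y in ball x₀ r₀, u y ∂μ) ∞ (μ.restrict (ball x₀ r₀)) ≤
        ENNReal.ofReal (C * r₀ ^ diffDim Q p s x₀) * N ∧
      ∃ v : X → ℝ, ContinuousOn v (ball x₀ r₀) ∧ u =ᵐ[μ.restrict (ball x₀ r₀)] v ∧
        ∀ x ∈ ball x₀ r₀, ∀ y ∈ ball x₀ r₀, ENNReal.ofReal |v x - v y| ≤
          ENNReal.ofReal ((2 ^ (essSup (diffDim Q p s) μ + 1) * C *
            (σ * δ / ((σ - 1) * r₀)) ^ essSup (diffDim Q p s) μ) *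
            dist x y ^ diffDim Q p s x) * N := by
  by_cases hex : ∃ ν : Measure X, Standing ν Q p s b δ ∧ EssLT ν Q (fun x => s x * p x)
  swap
  · exact ⟨1, one_pos, fun μ hμ hlt => absurd ⟨μ, hμ, hlt⟩ hex⟩
  obtain ⟨ν, hν, hlt⟩ := hex
  obtain ⟨lo, hi, hE⟩ := hν.exponents
  obtain ⟨c, hc, hα⟩ := hν.exists_le_diffDim hlt
  have hα0 : ∀ x, 0 < diffDim Q p s x := fun x => hc.trans_le (hα x)
  obtain ⟨C₁, hC₁, hholder⟩ := hE.exists_abs_sub_le hb hb1 δ hσ hc hα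
  obtain ⟨C₂, hC₂, hdist⟩ := hE.exists_dist_rpow_diffDim_le hα0 δ
  have hC : 0 < C₁ * C₂ := by positivity
  refine ⟨C₁ * C₂, hC, fun μ hμ _ x₀ r₀ D u N hr hrδ hu hgrad => ?_⟩
  have := hμ.metricMeasure.isFiniteMeasure_restrict_ball x₀ hr
  have := hμ.metricMeasure.neZero_restrict_ball x₀ hr
  have : NeZero μ := ⟨fun h => NeZero.ne (μ.restrict (ball x₀ r₀)) (by simp [h])⟩
  have hBU : ball x₀ r₀ ⊆ ball x₀ (σ * r₀) := ball_subset_ball (by nlinarith)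
  have huh := hholder μ hμ.growth x₀ r₀ D u N hrδ hgrad
  have hosc : ∀ᵐ x ∂μ.restrict (ball x₀ r₀), ∀ᵐ y ∂μ.restrict (ball x₀ r₀),
      |u x - u y| ≤ C₁ * C₂ * r₀ ^ diffDim Q p s x₀ * N.toReal := by
    refine ae_ae_of_forall_mem_inter hBU hgrad.measure_diff fun x hx y hy => ?_
    calc |u x - u y| ≤ C₁ * N.toReal * dist x y ^ diffDim Q p s x := huh x hx y hy
      _ ≤ C₁ * N.toReal * (C₂ * r₀ ^ diffDim Q p s x₀) := by
          gcongr
          exact hdist x₀ r₀ hr hrδ x hx.2 y hy.2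
      _ = _ := by ring
  have hint : IntegrableOn u (ball x₀ r₀) μ := integrable_of_ae_abs_sub_le hu hosc
  obtain ⟨v, hvc, huv, hv⟩ := exists_holder_representative hμ.metricMeasure hBU hgrad.measure_diff
    hE.logHolder_diffDim.continuous hα0 huh
  have hC₁D := (le_mul_of_one_le_right hC₁.le hC₂).trans (le_mul_rpow_radius_ratio
    (hE.le_essSup_diffDim (μ := μ) fun x => (hα0 x).le) hC.le hσ hr hrδ)
  rw [← ENNReal.ofReal_toReal hgrad.ne_top, ← ENNReal.ofReal_mul (by positivity)]
  refine ⟨hint, eLpNorm_top_sub_average_le hint hosc, v, hvc, huv, fun x hx y hy => ?_⟩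
  rw [← ENNReal.ofReal_mul (mul_nonneg (hC₁.le.trans hC₁D) (by positivity)), mul_right_comm]
  refine ENNReal.ofReal_le_ofReal ((hv x hx y hy).trans ?_)
  gcongr

end Morrey

section LocalData

variable {X : Type*} [MetricSpace X] [MeasurableSpace X] {A : Scale} {μ : Measure X}
  {p s : X → ℝ} {δ σ : ℝ} {x₀ : X} {r₀ : ℝ} {q : X → ℝ≥0∞} {u : X → EReal} {g : ℤ → X → ℝ≥0∞}

lemma LocalData.radius_le_of_one_lt (hl : LocalData A μ s p δ σ x₀ r₀ q u g) (hσ : 1 < σ) :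
    r₀ ≤ δ := by
  have h := (le_div_iff₀ (one_pos.trans hσ)).1 hl.radius_le
  nlinarith [hl.radius_pos]

lemma LocalData.restrict_ball_le (hl : LocalData A μ s p δ σ x₀ r₀ q u g) (hσ : 1 < σ) :
    μ.restrict (ball x₀ r₀) ≤ μ.restrict (ball x₀ (σ * r₀)) :=
  Measure.restrict_mono_set μ (ball_subset_ball (by nlinarith [hl.radius_pos]))

lemma LocalData.aemeasurable_toReal (hl : LocalData A μ s p δ σ x₀ r₀ q u g) (hσ : 1 < σ) :
    AEMeasurable (fun x => (u x).toReal) (μ.restrict (ball x₀ r₀)) :=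
  measurable_ereal_toReal.comp_aemeasurable
    (hl.mem_space.aemeasurable.mono_measure (hl.restrict_ball_le hσ))

lemma LocalData.ae_eq_coe (hl : LocalData A μ s p δ σ x₀ r₀ q u g) (hσ : 1 < σ) {v : X → ℝ}
    (hv : (fun x => (u x).toReal) =ᵐ[μ.restrict (ball x₀ r₀)] v) :
    ∀ᵐ x ∂μ.restrict (ball x₀ r₀), u x = v x := by
  filter_upwards [hv, ae_mono (hl.restrict_ball_le hσ) hl.mem_space.finite_ae] with x hx hfin
  rw [← hx, EReal.coe_toReal hfin.1 hfin.2]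

end LocalData

end HajlaszVar

theorem mainTheorem4 {X : Type*} [MetricSpace X] [MeasurableSpace X] [BorelSpace X]
    (Q p s : X → ℝ) (b δ σ : ℝ) (hb : 0 < b) (hb1 : b ≤ 1) (hδ : 0 < δ) (hσ : 1 < σ)
    (A : HajlaszVar.Scale) :
    -- (i) Sobolev case
    (∃ CS : ℝ, 0 < CS ∧
      ∀ μ : Measure X, HajlaszVar.Standing μ Q p s b δ →
        HajlaszVar.EssLT μ (fun x => s x * p x) Q →
        ∀ (x₀ : X) (r₀ : ℝ) (q : X → ℝ≥0∞) (u : X → EReal) (g : ℤ → X → ℝ≥0∞),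
          HajlaszVar.LocalData A μ s p δ σ x₀ r₀ q u g →
          ∀ γ : X → ℝ, (∀ x, γ x = Q x * p x / (Q x - s x * p x)) →
            (⨅ c : ℝ, HajlaszVar.luxNorm μ (ball x₀ r₀) γ
                (fun x => ENNReal.ofReal |(u x).toReal - c|)) ≤
              ENNReal.ofReal (CS * ((μ (ball x₀ r₀)).toReal / r₀ ^ Q x₀) ^
                  (1 / essInf γ (μ.restrict (ball x₀ r₀)))) *
                HajlaszVar.mixedNorm A μ (ball x₀ (σ * r₀)) p q g) ∧
    -- (ii) Moser-Trudinger case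
    (∃ C1 C2 : ℝ, 0 < C1 ∧ 0 < C2 ∧
      ∀ μ : Measure X, HajlaszVar.Standing μ Q p s b δ →
        (∀ x, s x * p x = Q x) →
        ∀ (x₀ : X) (r₀ : ℝ) (q : X → ℝ≥0∞) (u : X → EReal) (g : ℤ → X → ℝ≥0∞),
          HajlaszVar.LocalData A μ s p δ σ x₀ r₀ q u g →
          0 < HajlaszVar.mixedNorm A μ (ball x₀ (σ * r₀)) p q g →
            IntegrableOn (fun x => (u x).toReal) (ball x₀ r₀) μ ∧
            (⨍⁻ x in ball x₀ r₀, ENNReal.ofReal (Real.exp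
                (C1 * (|(u x).toReal - ⨍ y in ball x₀ r₀, (u y).toReal ∂μ| /
                  (HajlaszVar.mixedNorm A μ (ball x₀ (σ * r₀)) p q g).toReal))) ∂μ) ≤
              ENNReal.ofReal C2) ∧
    -- (iii) Morrey case
    (∃ CH : ℝ, 0 < CH ∧
      ∀ μ : Measure X, HajlaszVar.Standing μ Q p s b δ →
        HajlaszVar.EssLT μ Q (fun x => s x * p x) →
        ∀ (x₀ : X) (r₀ : ℝ) (q : X → ℝ≥0∞) (u : X → EReal) (g : ℤ → X → ℝ≥0∞),
          HajlaszVar.LocalData A μ s p δ σ x₀ r₀ q u g →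
          ∀ α : X → ℝ, (∀ x, α x = s x - Q x / p x) →
            IntegrableOn (fun x => (u x).toReal) (ball x₀ r₀) μ ∧
            eLpNorm (fun x => (u x).toReal - ⨍ y in ball x₀ r₀, (u y).toReal ∂μ) ∞
                (μ.restrict (ball x₀ r₀)) ≤
              ENNReal.ofReal (CH * r₀ ^ α x₀) *
                HajlaszVar.mixedNorm A μ (ball x₀ (σ * r₀)) p q g ∧
            ∃ v : X → ℝ, ContinuousOn v (ball x₀ r₀) ∧
              (∀ᵐ x ∂(μ.restrict (ball x₀ r₀)), u x = (v x : EReal)) ∧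
              ∀ x ∈ ball x₀ r₀, ∀ y ∈ ball x₀ r₀,
                ENNReal.ofReal |v x - v y| ≤
                  ENNReal.ofReal ((2 ^ (essSup α μ + 1) * CH *
                      (σ * δ / ((σ - 1) * r₀)) ^ essSup α μ) * dist x y ^ α x) *
                    HajlaszVar.mixedNorm A μ (ball x₀ (σ * r₀)) p q g) := by
  obtain ⟨CS, hCS, sobolev⟩ := HajlaszVar.sobolev_embedding Q p s hb hb1 δ hσ
  obtain ⟨C₁, C₂, hC₁, hC₂, moserTrudinger⟩ :=
    HajlaszVar.moserTrudinger_embedding Q p s hb hb1 δ hσ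
  obtain ⟨CH, hCH, morrey⟩ := HajlaszVar.morrey_embedding Q p s hb hb1 δ hσ
  have scalarGradient : ∀ μ, HajlaszVar.Standing μ Q p s b δ → ∀ x₀ r₀ q u g,
      HajlaszVar.LocalData A μ s p δ σ x₀ r₀ q u g → ∃ D, HajlaszVar.HasScalarGradientBound μ p s
        (ball x₀ (σ * r₀)) D (fun x => (u x).toReal)
        (HajlaszVar.mixedNorm A μ (ball x₀ (σ * r₀)) p q g) := fun μ hμ x₀ r₀ q u g hl => by
    obtain ⟨lo, hi, hE⟩ := hμ.exponents
    exact hl.exists_hasScalarGradientBound hμ.exponent_p.continuous.measurable hE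
  refine ⟨⟨CS, hCS, fun μ hμ hlt x₀ r₀ q u g hl γ hγ => ?_⟩,
    ⟨C₁, C₂, hC₁, hC₂, fun μ hμ hQ x₀ r₀ q u g hl hN => ?_⟩,
    ⟨CH, hCH, fun μ hμ hlt x₀ r₀ q u g hl α hα => ?_⟩⟩ <;>
    obtain ⟨D, hD⟩ := scalarGradient μ hμ x₀ r₀ q u g hl
  · obtain rfl : γ = HajlaszVar.sobolevExponent Q p s := funext hγ
    exact sobolev μ hμ hlt x₀ r₀ D _ _ hl.radius_pos (hl.radius_le_of_one_lt hσ) hD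
  · exact moserTrudinger μ hμ hQ x₀ r₀ D _ _ hl.radius_pos (hl.radius_le_of_one_lt hσ)
      (hl.aemeasurable_toReal hσ) hD hN
  · obtain rfl : α = HajlaszVar.diffDim Q p s := funext hα
    obtain ⟨hint, hbound, v, hv, huv, hholder⟩ := morrey μ hμ hlt x₀ r₀ D _ _ hl.radius_pos
      (hl.radius_le_of_one_lt hσ) (hl.aemeasurable_toReal hσ) hD
    exact ⟨hint, hbound, v, hv, hl.ae_eq_coe hσ huv, hholder⟩
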